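/- **Setting.** Loops are maps $S^1\to SL(2,\mathbb C)$ with pointwise multiplication. $N^+$ is the group of loops that extend holomorphically, with values in $SL(2,\mathbb C)$, to a neighbourhood of the disk $\{|z|\le 1\}$, with upper triangular unipotent value at $z=0$. $N^-$ is the group of loops that extend holomorphically, with values in $SL(2,\mathbb C)$, to a neighbourhood of $\{|z|\ge1\}\cup\{\infty\}$, with lower triangular unipotent value at $z=\infty$. Put $$s_0=\begin{pmatrix}0&iz^{-1}\\ iz&0\end{pmatrix},\qquad s_1=\begin{pmatrix}0&i\\ i&0\end{pmatrix},\qquad w_0=1,\ w_1=s_0,\ w_2=s_1s_0,\ w_3=s_0s_1s_0,\dots$$ Let $i_{\alpha_0}\begin{pmatrix}a&b\\c&d\end{pmatrix}=\begin{pmatrix}d&cz^{-1}\\bz&a\end{pmatrix}$, let $i_{\alpha_1}$ be the inclusion of $SL(2,\mathbb C)$ as constant loops, and let $\gamma_j=\alpha_0$ for $j$ odd, $\gamma_j=\alpha_1$ for $j$ even. For $\zeta\in\mathbb C$ let $a(\zeta)=(1+|\zeta|^2)^{-1/2}$ and $$k(\zeta)=\begin{pmatrix}1&0\\ \zeta&1\end{pmatrix}\begin{pmatrix}a(\zeta)&0\\0&a(\zeta)^{-1}\end{pmatrix}\begin{pmatrix}1&-\bar\zeta\\0&1\end{pmatrix}\in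 SU(2),$$ and for $\zeta=(\zeta_1,\dots,\zeta_n)\in\mathbb C^n$ let $$g_\zeta=\bigl(w_{n-1}^{-1}\,i_{\gamma_n}(k(\zeta_n))\,w_{n-1}\bigr)\cdots\bigl(w_1^{-1}\,i_{\gamma_2}(k(\zeta_2))\,w_1\bigr)\,i_{\gamma_1}(k(\zeta_1)).$$ For a continuous loop $g$ let $A(g)$ be the Toeplitz operator with symbol $g$ on the Hardy space $H_+\subset L^2(S^1,\mathbb C^2)$ and, when the (Fredholm) determinant exists, $|\sigma_0|^2(g)=\det(A(g)^*A(g))$ and $$|\sigma_1|^2(g)=|\sigma_0|^2\left(\begin{pmatrix}z^{1/2}&0\\0&z^{-1/2}\end{pmatrix}g\begin{pmatrix}z^{-1/2}&0\\0&z^{1/2}\end{pmatrix}\right).$$ Finally, for $y=(y_1,\dots,y_m)\in\mathbb C^m$ let $B\bigl(\sum_{j=1}^m y_jz^j\bigr)$ be the lower triangular $m\times m$ matrix whose $(i,k)$ entry is $y_{m-i+k}$ for $k\le i$ and $0$ for $k>i$. Empty determinants and products are $1$. **Theorem.** Let $n>0$. (a) $\displaystyle N^-\cap w_n^{-1}N^+w_n=\left\{\begin{pmatrix}1&\sum_{j=1}^n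 x_jz^{-j}\\0&1\end{pmatrix}:\ x_j\in\mathbb C\right\}.$ For every $\zeta\in\mathbb C^n$, $g_\zeta$ takes values in $SU(2)$, and there is exactly one $l\in N^-\cap w_n^{-1}N^+w_n$ for which $g_\zeta=l\,\mathrm{diag}(t,t^{-1})\,u$ with a constant $t>0$ and some $u\in N^+$. Writing $x^{(n)}_j(\zeta)$, $1\le j\le n$, for the coordinates of this $l$ in (a), the map $\mathbb C^n\to\mathbb C^n$, $\zeta\mapsto x^{(n)}(\zeta)$, is a ($C^\infty$) diffeomorphism. (b) For $n<N$ and $1\le j\le n$, $\;x^{(n)}_j(\zeta_1,\dots,\zeta_n)=x^{(N)}_j(\zeta_1,\dots,\zeta_n,0,\dots,0)$. Moreover, for $1\le j\le n$ and every $N\ge n-j+1$, $\;x^{(n)}_j(\zeta_1,\dots,\zeta_n)=x^{(N)}_1(\zeta_j,\dots,\zeta_n,0,\dots,0)$. (c) Let $\zeta\in\mathbb C^n$, $g=g_\zeta$ and $x_j=x^{(n)}_j(\zeta)$. The determinants defining $|\sigma_0|^2(g)$ and $|\sigma_1|^2(g)$ exist, and $$|\sigma_0|^2(g)=\frac1{\det\bigl(1+B(\sum_{j=1}^n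 x_jz^j)B(\sum_{j=1}^n x_jz^j)^*\bigr)}=\prod_{j=1}^n\frac1{(1+|\zeta_j|^2)^j},$$ $$|\sigma_1|^2(g)=\frac1{\det\bigl(1+B(\sum_{j=1}^{n-1} x_{j+1}z^j)B(\sum_{j=1}^{n-1} x_{j+1}z^j)^*\bigr)}=\prod_{j=1}^{n-1}\frac1{(1+|\zeta_{j+1}|^2)^{j}}.$$ In particular $\displaystyle\frac{|\sigma_0|(g)}{|\sigma_1|(g)}=\prod_{j=1}^n\frac1{(1+|\zeta_j|^2)^{1/2}}.$ (d) More generally, for $0\le l<n$, $$\det\Bigl(1+B\bigl(\textstyle\sum_{j=1}^{n-l}x_{j+l}z^j\bigr)B\bigl(\sum_{j=1}^{n-l}x_{j+l}z^j\bigr)^*\Bigr)=\prod_{j=1}^{n-l}(1+|\zeta_{j+l}|^2)^j.$$ (e) With $\lambda$ Lebesgue measure on $\mathbb C$, under $x=x^{(n)}(\zeta)$, $$\prod_{j=1}^n d\lambda(x_j)=\prod_{j=2}^n(1+|\zeta_j|^2)^{2(j-1)}\ \prod_{j=1}^n d\lambda(\zeta_j).$$ -/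

import Mathlib

open MeasureTheory Filter Topology
open scoped ContDiff Matrix MatrixGroups

noncomputable section

namespace LoopSU2

/-- Loops in `SL(2, ℂ)`, with the pointwise group structure. -/
abbrev Loop : Type := Circle → SL(2, ℂ)

/-- `N⁺`: the loops that extend to a holomorphic `SL(2, ℂ)`-valued map `F` on (a neighbourhood of)
the closed unit disk with `F 0` upper triangular unipotent. -/
def Nplus : Set Loop :=
  {g | ∃ F : ℂ → Matrix (Fin 2) (Fin 2) ℂ,
    (∀ i j, AnalyticOnNhd ℂ (fun z => F z i j) (Metric.closedBall 0 1)) ∧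
    (∀ z ∈ Metric.closedBall (0 : ℂ) 1, (F z).det = 1) ∧
    F 0 0 0 = 1 ∧ F 0 1 0 = 0 ∧ F 0 1 1 = 1 ∧
    ∀ z : Circle, (g z : Matrix (Fin 2) (Fin 2) ℂ) = F (z : ℂ)}

/-- `N⁻`: the loops that extend to a holomorphic `SL(2, ℂ)`-valued map on (a neighbourhood of)
`{|z| ≥ 1} ∪ {∞}` whose value at `∞` is lower triangular unipotent. The extension is
`z ↦ F z⁻¹`, so that `F 0` is its value at `∞`. -/
def Nminus : Set Loop :=
  {g | ∃ F : ℂ → Matrix (Fin 2) (Fin 2) ℂ,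
    (∀ i j, AnalyticOnNhd ℂ (fun z => F z i j) (Metric.closedBall 0 1)) ∧
    (∀ z ∈ Metric.closedBall (0 : ℂ) 1, (F z).det = 1) ∧
    F 0 0 0 = 1 ∧ F 0 0 1 = 0 ∧ F 0 1 1 = 1 ∧
    ∀ z : Circle, (g z : Matrix (Fin 2) (Fin 2) ℂ) = F ((z : ℂ)⁻¹)}

/-- The representative of the simple reflection of the affine root `α₀`. -/
def s0 : Loop := fun z =>
  ⟨!![0, Complex.I * (z : ℂ)⁻¹; Complex.I * (z : ℂ), 0], by
    have hz : (z : ℂ) ≠ 0 := z.coe_ne_zero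
    rw [Matrix.det_fin_two_of]
    field_simp
    simp⟩

/-- The representative of the simple reflection of the root `α₁`. -/
def s1 : Loop := fun _ =>
  ⟨!![0, Complex.I; Complex.I, 0], by simp [Matrix.det_fin_two_of]⟩

/-- The minimal Weyl group sequence `w₀ = 1`, `w₁ = s₀`, `w₂ = s₁ s₀`, `w₃ = s₀ s₁ s₀`, … -/
def weyl : ℕ → Loop
  | 0 => 1
  | n + 1 => (if Even n then s0 else s1) * weyl n

/-- The root homomorphism of `α₀`. -/
def rootHom0 (m : SL(2, ℂ)) : Loop := fun z =>
  ⟨!![m.1 1 1, m.1 1 0 * (z : ℂ)⁻¹; m.1 0 1 * (z : ℂ), m.1 0 0], by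
    have hz : (z : ℂ) ≠ 0 := z.coe_ne_zero
    have hm := m.2
    rw [Matrix.det_fin_two] at hm
    rw [Matrix.det_fin_two_of]
    refine Eq.trans ?_ hm
    field_simp⟩

/-- The root homomorphism of `α₁`: constant loops. -/
def rootHom1 (m : SL(2, ℂ)) : Loop := fun _ => m

/-- The root homomorphism of the `(j + 1)`-st simple root in the sequence `α₀, α₁, α₀, …` -/
def rootHom (j : ℕ) : SL(2, ℂ) → Loop := if Even j then rootHom0 else rootHom1

/-- The positive number `a(ζ) = (1 + |ζ|²)^{-1/2}`. -/
def aCoef (ζ : ℂ) : ℝ := (Real.sqrt (1 + ‖ζ‖ ^ 2))⁻¹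

/-- The diagonal matrix `diag (t, t⁻¹)` for a positive real number `t`. -/
def diagPos (t : ℝ) (ht : 0 < t) : SL(2, ℂ) :=
  ⟨!![(t : ℂ), 0; 0, (t : ℂ)⁻¹], by
    have h : (t : ℂ) ≠ 0 := by exact_mod_cast ht.ne'
    simp [Matrix.det_fin_two_of, h]⟩

theorem aCoef_pos (ζ : ℂ) : 0 < aCoef ζ := by
  unfold aCoef
  positivity

/-- The element `k(ζ)` of `SU(2)`, through its triangular factorization. -/
def kMat (ζ : ℂ) : SL(2, ℂ) :=
  ⟨!![1, 0; ζ, 1], by simp [Matrix.det_fin_two_of]⟩ * diagPos (aCoef ζ) (aCoef_pos ζ) *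
    ⟨!![1, -(starRingEnd ℂ ζ); 0, 1], by simp [Matrix.det_fin_two_of]⟩

/-- The loop `g = (w_{n-1}⁻¹ i_{γ_n}(k(ζ_n)) w_{n-1}) ⋯ (w₁⁻¹ i_{γ₂}(k(ζ₂)) w₁) i_{γ₁}(k(ζ₁))`
of `ζ = (ζ₁, …, ζ_n)`; the entry of index `j : Fin n` stands for `ζ_{j+1}`. -/
def gLoop (n : ℕ) (ζ : Fin n → ℂ) : Loop :=
  (List.ofFn fun j : Fin n => (weyl j)⁻¹ * rootHom j (kMat (ζ j)) * weyl j).reverse.prod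

/-- The intersection `N⁻ ∩ w_n⁻¹ N⁺ w_n`. -/
def Ncell (n : ℕ) : Set Loop := Nminus ∩ (fun u => (weyl n)⁻¹ * u * weyl n) '' Nplus

/-- The unipotent loop with upper right entry `∑_{j=1}^n x_j z^{-j}`. -/
def unip {n : ℕ} (x : Fin n → ℂ) : Loop := fun z =>
  ⟨!![1, ∑ j : Fin n, x j * ((z : ℂ)⁻¹) ^ (j.val + 1); 0, 1], by simp [Matrix.det_fin_two_of]⟩

/-- `l` corresponds to `ζ`: `l` lies in `N⁻ ∩ w_n⁻¹ N⁺ w_n` and `g(ζ) = l a u` with `a` a positive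
diagonal matrix (constant in `z`) and `u ∈ N⁺`. -/
def Corresponds (n : ℕ) (ζ : Fin n → ℂ) (l : Loop) : Prop :=
  l ∈ Ncell n ∧ ∃ (t : ℝ) (ht : 0 < t), ∃ u ∈ Nplus,
    gLoop n ζ = l * (fun _ => diagPos t ht) * u

/-- The matrix `B(∑_{j=1}^n x_j z^j)`: row `i`, column `k` (counted from `0`) holds
`x_{n-i+k}` if `k ≤ i` and `0` otherwise. -/
def hankelB {n : ℕ} (x : Fin n → ℂ) : Matrix (Fin n) (Fin n) ℂ :=
  Matrix.of fun i k =>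
    if h : k ≤ i then x ⟨n - 1 - i.val + k.val, by have := i.2; have : k.val ≤ i.val := h; omega⟩
    else 0

/-- `(y_{l+1}, …, y_n)` for `y = (y_1, …, y_n)`. -/
def drop {n : ℕ} (l : ℕ) (y : Fin n → ℂ) : Fin (n - l) → ℂ :=
  fun j => y ⟨j.val + l, by have := j.2; omega⟩

/-- The first `N` terms of the sequence `(y_{l+1}, …, y_n, 0, 0, …)`. -/
def pad {n : ℕ} (N l : ℕ) (y : Fin n → ℂ) : Fin N → ℂ :=
  fun i => if h : i.val + l < n then y ⟨i.val + l, h⟩ else 0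

/-- The matrix of the Toeplitz operator `A(g)` on the Hardy space `H₊ ⊂ L²(S¹, ℂ²)`, in the
orthonormal basis `z^k ε_β`, `k ≥ 0`: the coefficient of `z^j ε_α` in `g z^k ε_β` is the Fourier
coefficient of index `j - k` of the entry `g_{αβ}`. -/
def toeplitz (g : Loop) : Matrix (ℕ × Fin 2) (ℕ × Fin 2) ℂ :=
  Matrix.of fun p q =>
    fourierCoeff (T := 1) (fun t => (g (AddCircle.toCircle t)).1 p.2 q.2) ((p.1 : ℤ) - q.1)

/-- The matrix of `A(g)* A(g)`. -/
def toeplitzGram (g : Loop) : Matrix (ℕ × Fin 2) (ℕ × Fin 2) ℂ :=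
  Matrix.of fun p q => ∑' r, starRingEnd ℂ (toeplitz g r p) * toeplitz g r q

/-- The determinant of the finite section of an infinite matrix on a finite set of indices. -/
def sectionDet {ι : Type*} [DecidableEq ι] (M : Matrix ι ι ℂ) (S : Finset ι) : ℂ :=
  (M.submatrix (Subtype.val : S → ι) Subtype.val).det

/-- `d` is the (Fredholm) determinant of the infinite matrix `M`, as the limit of the determinants
of the finite sections of `M`. -/
def HasInfDet {ι : Type*} [DecidableEq ι] (M : Matrix ι ι ℂ) (d : ℂ) : Prop :=
  Tendsto (sectionDet M) atTop (𝓝 d)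

/-- The determinant of an infinite matrix (meaningful if it exists, see `HasInfDet`). -/
def infDet {ι : Type*} [DecidableEq ι] (M : Matrix ι ι ℂ) : ℂ := limUnder atTop (sectionDet M)

/-- `|σ₀|(g)`, where `|σ₀|²(g) = det (A(g)* A(g))`. -/
def absSigma0 (g : Loop) : ℝ := Real.sqrt (infDet (toeplitzGram g)).re

/-- `diag (z^{1/2}, z^{-1/2}) g diag (z^{-1/2}, z^{1/2})`, a single-valued loop. -/
def halfConj (g : Loop) : Loop := fun z =>
  ⟨!![(g z).1 0 0, (z : ℂ) * (g z).1 0 1; (z : ℂ)⁻¹ * (g z).1 1 0, (g z).1 1 1], by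
    have hz : (z : ℂ) ≠ 0 := z.coe_ne_zero
    have hm := (g z).2
    rw [Matrix.det_fin_two] at hm
    rw [Matrix.det_fin_two_of]
    refine Eq.trans ?_ hm
    field_simp⟩

/-- `|σ₁|(g)`. -/
def absSigma1 (g : Loop) : ℝ := absSigma0 (halfConj g)

end LoopSU2

end

open LoopSU2

noncomputable section

namespace LoopSU2

/-! ### Laurent coefficients and the unnormalized product of the factors -/

open LaurentPolynomial

/-! After conjugation by the Weyl elements, the `j`-th factor of `g_ζ` is a positive multiple of the
matrix with rows `(1, ζ_j z^{-j})` and `(-ζ̄_j z^j, 1)`. Hence `g_ζ` is a positive constant times a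
matrix of Laurent polynomials `A, B; C, D` (`scat`), built by recursion on the tail `(ζ_2, …, ζ_n)`.
Here `C` and `D` are polynomials with `C(0) = 0` and `D(0) = 1`, and the upper row is determined by
them through unitarity.

With `x = ∑ x_j z^{-j}`, a factorization `g = l a u` requires that `A - xC` and `B - xD` have no
negative powers. This determines `x` recursively: `x_2, …, x_n` are the coordinates of the tail, and
`x_1` is affine in `ζ_1` with slope `∏_{j≥2} (1 + |ζ_j|²)`. So `coordEquiv` is a triangular
bijection, smooth in both directions. The slope gives the Jacobian, and the shift property holds by
construction. `pairing_coordEquiv` proves the vanishing conditions. Uniqueness of `l` is Liouville's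
theorem (`eq_apply_zero_of_eq_inv`).

The same conditions say that `1 + H*H`, for the Hankel matrix `H` of `x`, sends the coefficient
vector of `D` to `∏ (1 + |ζ_j|²)` times the first basis vector. Cramer's rule reduces its
determinant to that of the tail (`det_one_add_hankel`).

On the operator side, `A(g)*A(g) = 1 - K*K` with `K` of finite rank, so the determinant is that of
an `n × n` matrix `1 - KK*`. A Schur complement of that matrix is the matrix of the tail
(`det_defect`). Finally, the half-conjugate of `g_ζ` is the loop of the tail times a constant
unitary matrix, so `|σ₁|²` is `|σ₀|²` of the tail. -/

theorem coeff_C_mul (a : ℂ) (f : ℂ[T;T⁻¹]) (m : ℤ) : (C a * f).coeff m = a * f.coeff m := by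
  rw [← single_eq_C, AddMonoidAlgebra.coeff_single_mul_apply]
  simp

theorem coeff_T_mul (n : ℤ) (f : ℂ[T;T⁻¹]) (m : ℤ) : (T n * f).coeff m = f.coeff (m - n) := by
  rw [T, AddMonoidAlgebra.coeff_single_mul_apply, one_mul, neg_add_eq_sub]

theorem coeff_add (f h : ℂ[T;T⁻¹]) (m : ℤ) : (f + h).coeff m = f.coeff m + h.coeff m := rfl

theorem coeff_sub (f h : ℂ[T;T⁻¹]) (m : ℤ) : (f - h).coeff m = f.coeff m - h.coeff m := rfl

theorem coeff_one (m : ℤ) : (1 : ℂ[T;T⁻¹]).coeff m = if m = 0 then 1 else 0 := by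
  rw [← map_one C, C_apply]

/-- The unnormalized product of the loop factors: the loop of `ζ` is a positive multiple of it. -/
def scat : (n : ℕ) → (Fin n → ℂ) → Matrix (Fin 2) (Fin 2) ℂ[T;T⁻¹]
  | 0, _ => 1
  | n + 1, ζ =>
    let M := scat n (Fin.tail ζ)
    !![M 0 0 - C (starRingEnd ℂ (ζ 0)) * M 0 1, T (-1) * (C (ζ 0) * M 0 0 + M 0 1);
      T 1 * (M 1 0 - C (starRingEnd ℂ (ζ 0)) * M 1 1), M 1 1 + C (ζ 0) * M 1 0]

variable {n : ℕ}

theorem scat_zero (ζ : Fin 0 → ℂ) : scat 0 ζ = 1 := rfl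

theorem scat_succ_00 (ζ : Fin (n + 1) → ℂ) : scat (n + 1) ζ 0 0 =
    scat n (Fin.tail ζ) 0 0 - C (starRingEnd ℂ (ζ 0)) * scat n (Fin.tail ζ) 0 1 := rfl

theorem scat_succ_01 (ζ : Fin (n + 1) → ℂ) : scat (n + 1) ζ 0 1 =
    T (-1) * (C (ζ 0) * scat n (Fin.tail ζ) 0 0 + scat n (Fin.tail ζ) 0 1) := rfl

theorem scat_succ_10 (ζ : Fin (n + 1) → ℂ) : scat (n + 1) ζ 1 0 =
    T 1 * (scat n (Fin.tail ζ) 1 0 - C (starRingEnd ℂ (ζ 0)) * scat n (Fin.tail ζ) 1 1) := rfl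

theorem scat_succ_11 (ζ : Fin (n + 1) → ℂ) : scat (n + 1) ζ 1 1 =
    scat n (Fin.tail ζ) 1 1 + C (ζ 0) * scat n (Fin.tail ζ) 1 0 := rfl

theorem coeff_scat_succ_00 (ζ : Fin (n + 1) → ℂ) (m : ℤ) : (scat (n + 1) ζ 0 0).coeff m =
    (scat n (Fin.tail ζ) 0 0).coeff m -
      starRingEnd ℂ (ζ 0) * (scat n (Fin.tail ζ) 0 1).coeff m := by
  rw [scat_succ_00, coeff_sub, coeff_C_mul]

theorem coeff_scat_succ_01 (ζ : Fin (n + 1) → ℂ) (m : ℤ) : (scat (n + 1) ζ 0 1).coeff m =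
    ζ 0 * (scat n (Fin.tail ζ) 0 0).coeff (m + 1) + (scat n (Fin.tail ζ) 0 1).coeff (m + 1) := by
  rw [scat_succ_01, coeff_T_mul, coeff_add, coeff_C_mul, sub_neg_eq_add]

theorem coeff_scat_succ_10 (ζ : Fin (n + 1) → ℂ) (m : ℤ) : (scat (n + 1) ζ 1 0).coeff m =
    (scat n (Fin.tail ζ) 1 0).coeff (m - 1) -
      starRingEnd ℂ (ζ 0) * (scat n (Fin.tail ζ) 1 1).coeff (m - 1) := by
  rw [scat_succ_10, coeff_T_mul, coeff_sub, coeff_C_mul]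

theorem coeff_scat_succ_11 (ζ : Fin (n + 1) → ℂ) (m : ℤ) : (scat (n + 1) ζ 1 1).coeff m =
    (scat n (Fin.tail ζ) 1 1).coeff m + ζ 0 * (scat n (Fin.tail ζ) 1 0).coeff m := by
  rw [scat_succ_11, coeff_add, coeff_C_mul]

/-- On the circle the matrix is a multiple of an element of `SU(2)`, so its upper row is determined
by its lower row; this is that relation on Fourier coefficients. -/
theorem conj_coeff_scat (n : ℕ) (ζ : Fin n → ℂ) (m : ℤ) :
    starRingEnd ℂ ((scat n ζ 0 0).coeff m) = (scat n ζ 1 1).coeff (-m) ∧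
      starRingEnd ℂ ((scat n ζ 0 1).coeff m) = -(scat n ζ 1 0).coeff (-m) := by
  induction n generalizing m with
  | zero =>
    simp only [scat_zero, Matrix.one_apply_eq, coeff_one, neg_eq_zero, ne_eq, zero_ne_one,
      one_ne_zero, not_false_eq_true, Matrix.one_apply_ne]
    constructor
    · split_ifs <;> simp
    · simp
  | succ n ih =>
    have h := ih (Fin.tail ζ)
    simp only [coeff_scat_succ_00, coeff_scat_succ_01, coeff_scat_succ_10, coeff_scat_succ_11,
      map_sub, map_add, map_mul, (h _).1, (h _).2, Complex.conj_conj, neg_add']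
    constructor <;> ring

theorem coeff_scat_support (n : ℕ) (ζ : Fin n → ℂ) (m : ℤ) :
    (m < 0 ∨ n < m → (scat n ζ 1 1).coeff m = 0) ∧
      (m < 1 ∨ n < m → (scat n ζ 1 0).coeff m = 0) := by
  induction n generalizing m with
  | zero =>
    simp only [scat_zero, Matrix.one_apply_eq, coeff_one, ne_eq,
      not_false_eq_true, one_ne_zero, Matrix.one_apply_ne]
    refine ⟨fun h => if_neg ?_, fun _ => rfl⟩
    rintro rfl
    simp at h
  | succ n ih =>
    have h := ih (Fin.tail ζ)
    rw [coeff_scat_succ_11, coeff_scat_succ_10]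
    push_cast
    refine ⟨fun hm => ?_, fun hm => ?_⟩
    · rw [(h m).1 (by omega), (h m).2 (by omega)]
      simp
    · rw [(h _).1 (by omega), (h _).2 (by omega)]
      simp

theorem coeff_scat_11_zero (n : ℕ) (ζ : Fin n → ℂ) : (scat n ζ 1 1).coeff 0 = 1 := by
  induction n with
  | zero => simp [scat_zero]
  | succ n ih =>
    rw [coeff_scat_succ_11, ih, (coeff_scat_support n _ 0).2 (by simp)]
    simp

/-- The product of the numbers `1 + |ζ_j|²`. -/
def tsq {n : ℕ} (ζ : Fin n → ℂ) : ℝ := ∏ j, (1 + ‖ζ j‖ ^ 2)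

theorem tsq_pos (ζ : Fin n → ℂ) : 0 < tsq ζ := Finset.prod_pos fun _ _ => by positivity

theorem tsq_ne_zero (ζ : Fin n → ℂ) : (tsq ζ : ℂ) ≠ 0 := by exact_mod_cast (tsq_pos ζ).ne'

theorem tsq_succ (ζ : Fin (n + 1) → ℂ) :
    tsq ζ = (1 + ‖ζ 0‖ ^ 2) * tsq (Fin.tail ζ) := Fin.prod_univ_succ _

theorem ofReal_tsq_succ (ζ : Fin (n + 1) → ℂ) :
    (tsq ζ : ℂ) = (1 + ζ 0 * starRingEnd ℂ (ζ 0)) * tsq (Fin.tail ζ) := by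
  rw [tsq_succ, Complex.mul_conj']
  push_cast
  rfl

theorem scat_det (n : ℕ) (ζ : Fin n → ℂ) :
    scat n ζ 0 0 * scat n ζ 1 1 - scat n ζ 0 1 * scat n ζ 1 0 = C (tsq ζ : ℂ) := by
  induction n with
  | zero => simp [scat_zero, tsq]
  | succ n ih =>
    rw [ofReal_tsq_succ, map_mul, ← ih, scat_succ_00, scat_succ_01, scat_succ_10, scat_succ_11,
      map_add, map_mul, map_one]
    have hT : (T (-1) : ℂ[T;T⁻¹]) * T 1 = 1 := by rw [← T_add]; simp
    linear_combination (C (ζ 0) * scat n (Fin.tail ζ) 0 0 + scat n (Fin.tail ζ) 0 1) *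
      (-(scat n (Fin.tail ζ) 1 0) + C (starRingEnd ℂ (ζ 0)) * scat n (Fin.tail ζ) 1 1) * hT

/-! ### The coordinates and the identities that characterize them -/

/-- The coefficient of index `-m` of `(∑ x_j z^{-j}) f`. -/
def pairing {n : ℕ} (x : Fin n → ℂ) (f : ℂ[T;T⁻¹]) (m : ℤ) : ℂ :=
  ∑ j : Fin n, x j * f.coeff ((j.val : ℤ) + 1 - m)

theorem pairing_succ (x : Fin (n + 1) → ℂ) (f : ℂ[T;T⁻¹]) (m : ℤ) :
    pairing x f m = x 0 * f.coeff (1 - m) + pairing (Fin.tail x) f (m - 1) := by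
  rw [pairing, Fin.sum_univ_succ, pairing, Fin.val_zero, Nat.cast_zero, zero_add]
  congr 1
  refine Finset.sum_congr rfl fun j _ => ?_
  rw [Fin.tail, Fin.val_succ]
  congr 2
  push_cast
  ring

theorem pairing_add (x : Fin n → ℂ) (f h : ℂ[T;T⁻¹]) (m : ℤ) :
    pairing x (f + h) m = pairing x f m + pairing x h m := by
  simp only [pairing, coeff_add, mul_add, Finset.sum_add_distrib]

theorem pairing_sub (x : Fin n → ℂ) (f h : ℂ[T;T⁻¹]) (m : ℤ) :
    pairing x (f - h) m = pairing x f m - pairing x h m := by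
  simp only [pairing, coeff_sub, mul_sub, Finset.sum_sub_distrib]

theorem pairing_C_mul (x : Fin n → ℂ) (a : ℂ) (f : ℂ[T;T⁻¹]) (m : ℤ) :
    pairing x (C a * f) m = a * pairing x f m := by
  simp only [pairing, coeff_C_mul, Finset.mul_sum]
  exact Finset.sum_congr rfl fun _ _ => by ring

theorem pairing_T_mul (x : Fin n → ℂ) (k : ℤ) (f : ℂ[T;T⁻¹]) (m : ℤ) :
    pairing x (T k * f) m = pairing x f (m + k) := by
  simp only [pairing, coeff_T_mul, sub_sub]

/-- The coordinate change `ζ ↦ x⁽ⁿ⁾(ζ)`. -/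
def coordEquiv : (n : ℕ) → (Fin n → ℂ) ≃ (Fin n → ℂ)
  | 0 => Equiv.refl _
  | n + 1 =>
    -- The first coordinate is the one that kills the coefficient of `z^{-1}` in the upper right
    -- entry of `l⁻¹ g`. It is affine in `ζ 0` with nonzero slope, hence the explicit inverse.
    { toFun := fun ζ => Fin.cons (tsq (Fin.tail ζ) * ζ 0 -
          pairing (coordEquiv n (Fin.tail ζ)) (scat n (Fin.tail ζ) 1 1) 0)
        (coordEquiv n (Fin.tail ζ))
      invFun := fun x => Fin.cons ((x 0 + pairing (Fin.tail x)
          (scat n ((coordEquiv n).symm (Fin.tail x)) 1 1) 0) /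
            tsq ((coordEquiv n).symm (Fin.tail x)))
        ((coordEquiv n).symm (Fin.tail x))
      left_inv := fun ζ => by
        have := tsq_ne_zero (Fin.tail ζ)
        simp [this]
      right_inv := fun x => by
        have := tsq_ne_zero ((coordEquiv n).symm (Fin.tail x))
        simp [mul_div_cancel₀, this] }

theorem coordEquiv_zero (ζ : Fin (n + 1) → ℂ) : coordEquiv (n + 1) ζ 0 =
    tsq (Fin.tail ζ) * ζ 0 -
      pairing (coordEquiv n (Fin.tail ζ)) (scat n (Fin.tail ζ) 1 1) 0 := rfl

theorem tail_coordEquiv (ζ : Fin (n + 1) → ℂ) :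
    Fin.tail (coordEquiv (n + 1) ζ) = coordEquiv n (Fin.tail ζ) := rfl

/-- These are the conditions for `l⁻¹ g` to extend to the disk: `B - xD` and `A - xC` have no
negative powers, and the constant term of `A - xC` is `tsq ζ`. The upper row is written through the
lower one by unitarity. In the induction only the coefficient `m = 1` involves the new coordinate in
the first identity; everything else follows from the tail because `C` and `D` have no negative
powers. -/
theorem pairing_coordEquiv (n : ℕ) (ζ : Fin n → ℂ) :
    (∀ m : ℤ, 1 ≤ m → pairing (coordEquiv n ζ) (scat n ζ 1 1) m =
        -starRingEnd ℂ ((scat n ζ 1 0).coeff m)) ∧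
      ∀ k : ℤ, 0 ≤ k → starRingEnd ℂ ((scat n ζ 1 1).coeff k) -
        pairing (coordEquiv n ζ) (scat n ζ 1 0) k = if k = 0 then (tsq ζ : ℂ) else 0 := by
  induction n with
  | zero => simp [pairing, scat_zero, coeff_one, tsq]
  | succ n ih =>
    obtain ⟨h1, h2⟩ := ih (Fin.tail ζ)
    have hD := coeff_scat_11_zero n (Fin.tail ζ)
    have hC := (coeff_scat_support n (Fin.tail ζ) 0).2 (by simp)
    have h20 := h2 0 le_rfl
    rw [hD, map_one, if_pos rfl] at h20
    refine ⟨fun m hm => ?_, fun k hk => ?_⟩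
    · rw [pairing_succ, tail_coordEquiv, coeff_scat_succ_11, scat_succ_11, pairing_add,
        pairing_C_mul, coeff_scat_succ_10, map_sub (starRingEnd ℂ), map_mul, Complex.conj_conj]
      rcases hm.eq_or_lt with rfl | hm
      -- The case that dictates the definition of the first coordinate; the slope `tsq` of the tail
      -- enters through the constant term of `A - xC`.
      · rw [coordEquiv_zero, sub_self, hD, hC, map_zero, map_one]
        linear_combination -ζ 0 * h20
      · have h2' := h2 (m - 1) (by omega)
        rw [if_neg (by omega)] at h2'
        rw [(coeff_scat_support n (Fin.tail ζ) (1 - m)).1 (by omega),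
          (coeff_scat_support n (Fin.tail ζ) (1 - m)).2 (by omega), h1 _ (by omega)]
        linear_combination -ζ 0 * h2'
    · rw [pairing_succ, tail_coordEquiv, coeff_scat_succ_10, scat_succ_10, pairing_T_mul,
        pairing_sub, pairing_C_mul, coeff_scat_succ_11, map_add (starRingEnd ℂ), map_mul,
        sub_add_cancel]
      rcases hk.eq_or_lt with rfl | hk
      · rw [coordEquiv_zero, sub_zero, sub_self, hD, hC, map_zero, map_one, ofReal_tsq_succ,
          if_pos rfl]
        linear_combination h20
      · have h2' := h2 k hk.le
        rw [if_neg hk.ne'] at h2' ⊢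
        rw [(coeff_scat_support n (Fin.tail ζ) (1 - k - 1)).1 (by omega),
          (coeff_scat_support n (Fin.tail ζ) (1 - k - 1)).2 (by omega), h1 _ (by omega)]
        linear_combination h2'

/-! ### The determinants of `1 + B B*` -/

/-- The Hankel matrix with entry `x_{m + k + 1}` in row `m` and column `k`. -/
def hankel {n : ℕ} (x : Fin n → ℂ) : Matrix (Fin n) (Fin n) ℂ :=
  Matrix.of fun m k => if h : m.val + k.val < n then x ⟨m + k, h⟩ else 0

theorem hankel_comm (x : Fin n → ℂ) (m k : Fin n) : hankel x m k = hankel x k m := by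
  simp only [hankel, Matrix.of_apply, add_comm m.val]

theorem hankelB_eq (x : Fin n → ℂ) : hankelB x = (hankel x).submatrix Fin.revPerm id := by
  ext i k
  simp only [hankelB, hankel, Matrix.of_apply, Matrix.submatrix_apply, Fin.revPerm_apply,
    Fin.val_rev, id_eq]
  by_cases h : k ≤ i
  · have h' : k.val ≤ i.val := h
    rw [dif_pos h, dif_pos (by omega)]
    congr 2
    omega
  · have h' : ¬ k.val ≤ i.val := h
    rw [dif_neg h, dif_neg (by omega)]

/-- Reversing the rows turns `B` into a symmetric Hankel matrix and conjugates `BB*` by a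
permutation; Sylvester's identity then swaps the two factors. -/
theorem det_one_add_hankelB (x : Fin n → ℂ) :
    (1 + hankelB x * (hankelB x)ᴴ).det = (1 + (hankel x)ᴴ * hankel x).det := by
  rw [← Matrix.det_one_add_mul_comm (hankel x), hankelB_eq, Matrix.conjTranspose_submatrix]
  have : (hankel x).submatrix Fin.revPerm id * (hankel x)ᴴ.submatrix id Fin.revPerm =
      (hankel x * (hankel x)ᴴ).submatrix Fin.revPerm Fin.revPerm := by
    ext i j
    simp [Matrix.mul_apply]
  rw [this, ← Matrix.det_submatrix_equiv_self Fin.revPerm (1 + hankel x * (hankel x)ᴴ),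
    Matrix.submatrix_add, Pi.add_apply, Pi.add_apply, Matrix.submatrix_one_equiv]

theorem sum_hankel_mul (x : Fin n → ℂ) (f : ℂ[T;T⁻¹]) (hf : ∀ m < 0, f.coeff m = 0) (m : Fin n) :
    ∑ k, hankel x m k * f.coeff (k.val : ℤ) = pairing x f (m.val + 1) := by
  have hR : pairing x f (m.val + 1) = ∑ j ∈ Finset.range n,
      if h : j < n then x ⟨j, h⟩ * f.coeff ((j : ℤ) - m) else 0 := by
    rw [Finset.sum_range]
    refine Finset.sum_congr rfl fun j _ => ?_
    rw [dif_pos j.2, add_sub_add_right_eq_sub]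
  have hL : ∑ k, hankel x m k * f.coeff (k.val : ℤ) = ∑ k ∈ Finset.range (n - m),
      if h : m + k < n then x ⟨m + k, h⟩ * f.coeff (((m + k : ℕ) : ℤ) - m) else 0 := by
    have hs : Finset.range (n - m) ⊆ Finset.range n := by
      intro k; simp only [Finset.mem_range]; omega
    rw [Finset.sum_subset hs, Finset.sum_range]
    · refine Finset.sum_congr rfl fun k _ => ?_
      simp only [hankel, Matrix.of_apply]
      split_ifs
      · push_cast; rw [add_sub_cancel_left]
      · rw [zero_mul]
    · intro k _ hk
      rw [Finset.mem_range] at hk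
      rw [dif_neg (by omega)]
  have hsplit : Finset.range n = Finset.range (m.val + (n - m.val)) := by
    congr 1; omega
  rw [hL, hR, hsplit, Finset.sum_range_add, right_eq_add]
  refine Finset.sum_eq_zero ?_
  intro j hj
  rw [Finset.mem_range] at hj
  rw [hf _ (by omega)]
  simp

/-- By the first identity of `pairing_coordEquiv`, `H` sends the coefficients of `D` to minus the
conjugated coefficients of `C`. As `H` is symmetric, applying `H*` gives the conjugate of the
pairing in the second identity. -/
theorem one_add_hankel_mulVec (ζ : Fin n → ℂ) (k : Fin n) :
    ∑ i, (1 + (hankel (coordEquiv n ζ))ᴴ * hankel (coordEquiv n ζ)) k i *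
      (scat n ζ 1 1).coeff (i.val : ℤ) = if k.val = 0 then (tsq ζ : ℂ) else 0 := by
  obtain ⟨h1, h2⟩ := pairing_coordEquiv n ζ
  have hD := coeff_scat_support n ζ
  have key : ∀ m, ∑ i, hankel (coordEquiv n ζ) m i * (scat n ζ 1 1).coeff (i.val : ℤ) =
      -starRingEnd ℂ ((scat n ζ 1 0).coeff (m.val + 1)) := fun m => by
    rw [sum_hankel_mul _ _ (fun m hm => (hD m).1 (Or.inl hm)), h1 _ (by omega)]
  have key2 : ∑ m, hankel (coordEquiv n ζ) k m * (scat n ζ 1 0).coeff ((m.val : ℤ) + 1) =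
      pairing (coordEquiv n ζ) (scat n ζ 1 0) k := by
    have := sum_hankel_mul (coordEquiv n ζ) (T (-1) * scat n ζ 1 0)
      (fun m hm => by rw [coeff_T_mul]; exact (hD _).2 (Or.inl (by omega))) k
    rw [pairing_T_mul, add_neg_cancel_right] at this
    rw [← this]
    exact Finset.sum_congr rfl fun m _ => by rw [coeff_T_mul, sub_neg_eq_add]
  have hk := congrArg (starRingEnd ℂ) (h2 k (by omega))
  rw [map_sub, Complex.conj_conj, ← key2, map_sum] at hk
  simp only [Matrix.add_apply, add_mul, Finset.sum_add_distrib, Matrix.one_apply, ite_mul, one_mul,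
    zero_mul, Finset.sum_ite_eq, Finset.mem_univ, if_true, Matrix.mul_apply, Finset.sum_mul,
    mul_assoc]
  rw [Finset.sum_comm]
  simp only [← Finset.mul_sum, key, Matrix.conjTranspose_apply]
  rw [apply_ite (starRingEnd ℂ), map_zero, Complex.conj_ofReal] at hk
  simp only [Nat.cast_eq_zero] at hk
  rw [← hk, sub_eq_add_neg, ← Finset.sum_neg_distrib]
  congr 1
  refine Finset.sum_congr rfl fun m _ => ?_
  rw [map_mul, hankel_comm _ m k, mul_neg]
  rfl

/-- Dropping the first column of a Hankel matrix leaves the Hankel matrix of the tail above a zero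
row, and a zero row does not affect the Gram matrix. -/
theorem hankel_gram_succ (x : Fin (n + 1) → ℂ) :
    (1 + (hankel x)ᴴ * hankel x).submatrix Fin.succ Fin.succ =
      1 + (hankel (Fin.tail x))ᴴ * hankel (Fin.tail x) := by
  have hs : ∀ (m : Fin n) (k : Fin n), hankel x m.castSucc k.succ = hankel (Fin.tail x) m k := by
    intro m k
    simp only [hankel, Matrix.of_apply, Fin.val_castSucc, Fin.val_succ, Fin.tail]
    split_ifs with h1 h2 h2
    · rfl
    · omega
    · omega
    · rfl
  have hl : ∀ k : Fin n, hankel x (Fin.last n) k.succ = 0 := fun k => by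
    simp only [hankel, Matrix.of_apply, Fin.val_last, Fin.val_succ]
    rw [dif_neg (by omega)]
  ext i j
  simp [Matrix.mul_apply, Fin.sum_univ_castSucc, hs, hl, Matrix.one_apply]

theorem det_one_add_hankel (n : ℕ) (ζ : Fin n → ℂ) :
    (1 + (hankel (coordEquiv n ζ))ᴴ * hankel (coordEquiv n ζ)).det =
      ((∏ j : Fin n, (1 + ‖ζ j‖ ^ 2) ^ (j.val + 1) : ℝ) : ℂ) := by
  induction n with
  | zero => simp
  | succ n ih =>
    set M := 1 + (hankel (coordEquiv (n + 1) ζ))ᴴ * hankel (coordEquiv (n + 1) ζ) with hM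
    -- Cramer's rule: since `D(0) = 1`, replacing the first column by `M` applied to the
    -- coefficients of `D` preserves the determinant, and the new column is supported in its first
    -- entry.
    have h := Matrix.det_updateCol_sum M 0 (fun i => (scat (n + 1) ζ 1 1).coeff (i.val : ℤ))
    simp only [smul_eq_mul, Fin.val_zero, Nat.cast_zero, coeff_scat_11_zero, one_mul] at h
    have hv : (fun k => ∑ i, (scat (n + 1) ζ 1 1).coeff (i.val : ℤ) * M k i) =
        fun k : Fin (n + 1) => if k.val = 0 then (tsq ζ : ℂ) else 0 := by
      ext k
      rw [← one_add_hankel_mulVec ζ k]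
      exact Finset.sum_congr rfl fun i _ => mul_comm _ _
    rw [hv] at h
    rw [← h, Matrix.det_succ_column_zero, Fin.sum_univ_succ]
    simp only [Fin.val_zero, pow_zero, Matrix.updateCol_self, if_true, one_mul, Fin.val_succ,
      Nat.succ_ne_zero, if_false, mul_zero, zero_mul, Finset.sum_const_zero, add_zero]
    have hsub : (M.updateCol 0 fun k => if k.val = 0 then (tsq ζ : ℂ) else 0).submatrix
        (Fin.succAbove 0) Fin.succ = M.submatrix Fin.succ Fin.succ := by
      ext i j
      simp [Fin.succ_ne_zero]
    rw [hsub, hM, hankel_gram_succ, tail_coordEquiv, ih, tsq, ← Complex.ofReal_mul]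
    congr 1
    rw [Fin.prod_univ_succ, Fin.prod_univ_succ (fun j : Fin (n + 1) => _ ^ (j.val + 1)), mul_assoc,
      ← Finset.prod_mul_distrib]
    simp [Fin.tail, pow_succ' _ (_ + 1)]

/-! ### Shifting and padding -/

theorem coordEquiv_shift (n m l : ℕ) (h : n = m + l) (ζ : Fin n → ℂ) (j : Fin m) :
    coordEquiv n ζ ⟨j.val + l, by omega⟩ =
      coordEquiv m (fun i : Fin m => ζ ⟨i.val + l, by omega⟩) j := by
  induction l generalizing n with
  | zero =>
    obtain rfl : n = m := h
    rfl
  | succ l ih =>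
    obtain ⟨n, rfl⟩ : ∃ k, n = k + 1 := ⟨m + l, by omega⟩
    exact ih n (by omega) (Fin.tail ζ)

theorem drop_coordEquiv (n l : ℕ) (h : l ≤ n) (ζ : Fin n → ℂ) :
    drop l (coordEquiv n ζ) = coordEquiv (n - l) (drop l ζ) :=
  funext fun j => coordEquiv_shift n (n - l) l (by omega) ζ j

theorem pairing_castSucc (x : Fin (n + 1) → ℂ) (hx : x (Fin.last n) = 0) (f : ℂ[T;T⁻¹]) (m : ℤ) :
    pairing x f m = pairing (fun j : Fin n => x j.castSucc) f m := by
  simp [pairing, Fin.sum_univ_castSucc, hx]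

/-- A vanishing last parameter contributes an identity factor. The claims are proved jointly because
the recursion for the first coordinate uses `tsq`, the lower right entry and the remaining
coordinates. -/
theorem castSucc_of_last_eq_zero (n : ℕ) (ζ : Fin (n + 1) → ℂ) (hζ : ζ (Fin.last n) = 0) :
    scat (n + 1) ζ 1 0 = scat n (fun j => ζ j.castSucc) 1 0 ∧
    scat (n + 1) ζ 1 1 = scat n (fun j => ζ j.castSucc) 1 1 ∧
    tsq ζ = tsq (fun j : Fin n => ζ j.castSucc) ∧
    (∀ j : Fin n, coordEquiv (n + 1) ζ j.castSucc = coordEquiv n (fun j => ζ j.castSucc) j) ∧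
    coordEquiv (n + 1) ζ (Fin.last n) = 0 := by
  induction n with
  | zero =>
    have h0 : ζ 0 = 0 := hζ
    refine ⟨?_, ?_, ?_, fun j => j.elim0, ?_⟩
    · rw [scat_succ_10, h0, scat_zero, scat_zero]; simp
    · rw [scat_succ_11, h0, scat_zero, scat_zero]; simp
    · simp [tsq, h0]
    · change coordEquiv 1 ζ 0 = 0
      rw [coordEquiv_zero, h0]
      simp [pairing]
  | succ n ih =>
    obtain ⟨h1, h2, h3, h4, h5⟩ := ih (Fin.tail ζ) hζ
    have ht : (fun j : Fin n => Fin.tail ζ j.castSucc) =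
      Fin.tail fun j : Fin (n + 1) => ζ j.castSucc := rfl
    rw [ht] at h1 h2 h3 h4
    have h4' : (fun j : Fin n => coordEquiv (n + 1) (Fin.tail ζ) j.castSucc) =
      coordEquiv n (Fin.tail fun j : Fin (n + 1) => ζ j.castSucc) := funext h4
    refine ⟨?_, ?_, ?_, fun j => ?_, h5⟩
    · rw [scat_succ_10 ζ, scat_succ_10 fun j : Fin (n + 1) => ζ j.castSucc, h1, h2]; rfl
    · rw [scat_succ_11 ζ, scat_succ_11 fun j : Fin (n + 1) => ζ j.castSucc, h1, h2]; rfl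
    · rw [tsq_succ ζ, tsq_succ fun j : Fin (n + 1) => ζ j.castSucc, h3]; rfl
    · refine Fin.cases ?_ (fun j => ?_) j
      · rw [Fin.castSucc_zero, coordEquiv_zero, coordEquiv_zero, pairing_castSucc _ h5, h4', h2, h3]
        rfl
      · exact h4 j

theorem coordEquiv_pad (n N : ℕ) (hN : n ≤ N) (ζ : Fin n → ℂ) (j : Fin n) :
    coordEquiv n ζ j = coordEquiv N (pad N 0 ζ) (Fin.castLE hN j) := by
  induction N, hN using Nat.le_induction with
  | base =>
    have : pad n 0 ζ = ζ := by
      ext i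
      simp [pad]
    rw [this]
    rfl
  | succ N hN ih =>
    have hl : pad (N + 1) 0 ζ (Fin.last N) = 0 := by
      rw [pad, dif_neg (by simp only [Fin.val_last]; omega)]
    rw [ih]
    exact ((castSucc_of_last_eq_zero N _ hl).2.2.2.1 (Fin.castLE hN j)).symm

theorem coordEquiv_pad_drop (n N : ℕ) (j : Fin n) (hN : n - j.val ≤ N) (ζ : Fin n → ℂ) :
    coordEquiv n ζ j =
      coordEquiv N (pad N j.val ζ) ⟨0, lt_of_lt_of_le (Nat.sub_pos_of_lt j.2) hN⟩ := by
  have h1 : coordEquiv n ζ j = drop j.val (coordEquiv n ζ) ⟨0, Nat.sub_pos_of_lt j.2⟩ := by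
    simp [drop]
  have h2 : pad N 0 (drop j.val ζ) = pad N j.val ζ := by
    ext i
    simp only [pad, drop, add_zero]
    split_ifs <;> first | rfl | omega
  rw [h1, drop_coordEquiv n j.val j.2.le, coordEquiv_pad _ N hN, h2]
  rfl

/-! ### Evaluation on the circle and Fourier coefficients -/

/-- Evaluation of a Laurent polynomial at a point of the circle. -/
def ev (z : Circle) : ℂ[T;T⁻¹] →+* ℂ := eval₂ (RingHom.id ℂ) (Circle.toUnits z)

theorem ev_C (z : Circle) (a : ℂ) : ev z (C a) = a := eval₂_C _ _ _

theorem ev_T (z : Circle) (m : ℤ) : ev z (T m) = (z : ℂ) ^ m := by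
  rw [ev, eval₂_T]
  simp

theorem continuous_ev (f : ℂ[T;T⁻¹]) : Continuous fun z : Circle => ev z f := by
  induction f using LaurentPolynomial.induction_on' with
  | add f h hf hh => exact (hf.add hh).congr fun z => (map_add _ _ _).symm
  | C_mul_T m a =>
    simp only [map_mul, ev_C, ev_T]
    exact continuous_const.mul
      (continuous_induced_dom.zpow₀ m fun z => Or.inl z.coe_ne_zero)

theorem fourierCoeff_ev (f : ℂ[T;T⁻¹]) (m : ℤ) :
    fourierCoeff (T := 1) (fun t => ev (AddCircle.toCircle t) f) m = f.coeff m := by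
  have hint : ∀ f, Integrable (fun t : AddCircle (1 : ℝ) => ev (AddCircle.toCircle t) f)
      AddCircle.haarAddCircle := fun f =>
    ((continuous_ev f).comp AddCircle.continuous_toCircle).integrable_of_hasCompactSupport
      (HasCompactSupport.of_compactSpace _)
  induction f using LaurentPolynomial.induction_on' with
  | add f h hf hh =>
    rw [coeff_add, ← hf, ← hh]
    refine Eq.trans ?_ (congrFun (fourierCoeff.add (hint f) (hint h)) m)
    simp only [map_add]
    rfl
  | C_mul_T k a =>
    have : (fun t : AddCircle (1 : ℝ) => ev (AddCircle.toCircle t) (C a * T k)) =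
        fun t => a * fourier k t := by
      ext t
      rw [map_mul, ev_C, ev_T, fourier_apply, AddCircle.toCircle_zsmul, Circle.coe_zpow]
    rw [this, fourierCoeff.const_mul, fourierCoeff_fourier, coeff_C_mul, T_apply, Pi.single_apply]
    simp only [eq_comm]

theorem hasSum_coeff_mul (f h : ℂ[T;T⁻¹]) (k l : ℤ) :
    HasSum (fun j : ℤ => f.coeff (k - j) * h.coeff (j - l)) ((f * h).coeff (k - l)) := by
  induction f using LaurentPolynomial.induction_on' with
  | add f f' hf hf' =>
    simp only [add_mul, coeff_add]
    exact hf.add hf'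
  | C_mul_T n a =>
    have h1 : (C a * T n * h).coeff (k - l) =
        (C a * T n).coeff (k - (k - n)) * h.coeff (k - n - l) := by
      rw [mul_assoc, coeff_C_mul, coeff_T_mul, coeff_C_mul, T_apply, if_pos (by ring), mul_one]
      congr 2
      ring
    rw [h1]
    refine hasSum_single _ fun j hj => ?_
    rw [coeff_C_mul, T_apply, if_neg (by omega), mul_zero, zero_mul]

/-! ### Toeplitz operators of unitary Laurent polynomial loops -/

section Gram

variable {g : Loop} {p q : Fin 2 → Fin 2 → ℂ[T;T⁻¹]}

theorem toeplitz_apply (hg : ∀ z i j, (g z).1 i j = ev z (p i j)) (r s : ℕ × Fin 2) :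
    toeplitz g r s = (p r.2 s.2).coeff ((r.1 : ℤ) - s.1) := by
  rw [← fourierCoeff_ev, toeplitz, Matrix.of_apply]
  simp only [hg]

theorem finite_support_coeff_sub (f : ℂ[T;T⁻¹]) (k : ℤ) :
    {j : ℕ | f.coeff ((j : ℤ) - k) ≠ 0}.Finite := by
  have hinj : Function.Injective fun j : ℕ => (j : ℤ) - k := fun a b h => by
    simpa using h
  exact (f.coeff.hasFiniteSupport).preimage hinj.injOn

/-- The summand of the Gram matrix of the columns `(k, i)` and `(l, j)` at the row `(m, a)`. -/
def gramTerm (p : Fin 2 → Fin 2 → ℂ[T;T⁻¹]) (r s : ℕ × Fin 2) (m : ℤ) (a : Fin 2) : ℂ :=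
  starRingEnd ℂ ((p a r.2).coeff (m - r.1)) * (p a s.2).coeff (m - s.1)

/-- Multiplication by a unitary loop is isometric on all of `L²`: summed over all integer rows, its
columns are orthonormal. The family `q` plays the role of the adjoint, which is also the inverse. -/
theorem hasSum_gramTerm_int
    (hq : ∀ i j m, starRingEnd ℂ ((p i j).coeff m) = (q j i).coeff (-m))
    (hqp : ∀ i j, q i 0 * p 0 j + q i 1 * p 1 j = if i = j then 1 else 0) (r s : ℕ × Fin 2) :
    HasSum (fun m : ℤ => gramTerm p r s m 0 + gramTerm p r s m 1)
      ((1 : Matrix (ℕ × Fin 2) (ℕ × Fin 2) ℂ) r s) := by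
  obtain ⟨k, i⟩ := r
  obtain ⟨l, j⟩ := s
  have h := (hasSum_coeff_mul (q i 0) (p 0 j) k l).add (hasSum_coeff_mul (q i 1) (p 1 j) k l)
  rw [← coeff_add, hqp] at h
  have hv : (if i = j then (1 : ℂ[T;T⁻¹]) else 0).coeff ((k : ℤ) - l) =
      (1 : Matrix (ℕ × Fin 2) (ℕ × Fin 2) ℂ) (k, i) (l, j) := by
    by_cases hij : i = j
    · by_cases hkl : k = l
      · subst hij hkl
        simp
      · rw [Matrix.one_apply_ne (by simp [hkl]), if_pos hij, coeff_one, if_neg (by omega)]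
    · rw [Matrix.one_apply_ne (by simp [hij]), if_neg hij]
      rfl
  rw [← hv]
  simpa only [gramTerm, hq, neg_sub] using h

theorem hasSum_gramTerm_neg (hlow : ∀ j m, m < 0 → (p 1 j).coeff m = 0)
    (hup : ∀ j m, m < -(n : ℤ) → (p 0 j).coeff m = 0) (r s : ℕ × Fin 2) :
    HasSum (fun m : ℕ => gramTerm p r s (-((m : ℤ) + 1)) 0 + gramTerm p r s (-((m : ℤ) + 1)) 1)
      (∑ m : Fin n, gramTerm p r s (-((m.val : ℤ) + 1)) 0) := by
  have h1 : ∀ m : ℕ, gramTerm p r s (-((m : ℤ) + 1)) 1 = 0 := fun m => by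
    rw [gramTerm, hlow _ _ (by omega), map_zero, zero_mul]
  simp only [h1, add_zero]
  rw [← Finset.sum_range fun m : ℕ => gramTerm p r s (-((m : ℤ) + 1)) 0]
  refine hasSum_sum_of_ne_finset_zero fun m hm => ?_
  rw [Finset.mem_range] at hm
  rw [gramTerm, hup _ _ (by omega), map_zero, zero_mul]

theorem summable_gramTerm (p : Fin 2 → Fin 2 → ℂ[T;T⁻¹]) (r s : ℕ × Fin 2) :
    Summable fun t : ℕ × Fin 2 => gramTerm p r s t.1 t.2 := by
  refine summable_of_hasFiniteSupport (Set.Finite.subset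
    (Set.finite_iUnion fun a : Fin 2 =>
      (finite_support_coeff_sub (p a s.2) s.1).image fun m => (m, a)) ?_)
  rintro ⟨m, a⟩ hm
  exact Set.mem_iUnion.2 ⟨a, m, right_ne_zero_of_mul hm, rfl⟩

theorem toeplitzGram_eq_tsum (hg : ∀ z i j, (g z).1 i j = ev z (p i j)) (r s : ℕ × Fin 2) :
    toeplitzGram g r s = ∑' m : ℕ, (gramTerm p r s m 0 + gramTerm p r s m 1) := by
  have h : toeplitzGram g r s = ∑' t : ℕ × Fin 2, gramTerm p r s t.1 t.2 := by
    rw [toeplitzGram, Matrix.of_apply]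
    simp only [toeplitz_apply hg]
    rfl
  rw [h, (summable_gramTerm p r s).tsum_prod]
  simp only [tsum_fintype, Fin.sum_univ_two]

/-- `A*A = 1 - K*K`, where `K` collects the Fourier modes of negative index, which the Hardy
projection discards. Only the upper row has such modes, and only `n` of them. -/
theorem toeplitzGram_apply (hg : ∀ z i j, (g z).1 i j = ev z (p i j))
    (hq : ∀ i j m, starRingEnd ℂ ((p i j).coeff m) = (q j i).coeff (-m))
    (hqp : ∀ i j, q i 0 * p 0 j + q i 1 * p 1 j = if i = j then 1 else 0)
    (hlow : ∀ j m, m < 0 → (p 1 j).coeff m = 0)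
    (hup : ∀ j m, m < -(n : ℤ) → (p 0 j).coeff m = 0) (r s : ℕ × Fin 2) :
    toeplitzGram g r s = (1 : Matrix (ℕ × Fin 2) (ℕ × Fin 2) ℂ) r s -
      ∑ m : Fin n, gramTerm p r s (-((m.val : ℤ) + 1)) 0 := by
  have htot := hasSum_gramTerm_int hq hqp r s
  have hpos : Summable fun m : ℕ => gramTerm p r s m 0 + gramTerm p r s m 1 :=
    htot.summable.comp_injective (i := fun m : ℕ => (m : ℤ)) Nat.cast_injective
  rw [toeplitzGram_eq_tsum hg, eq_sub_iff_add_eq]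
  have h := HasSum.of_nat_of_neg_add_one (f := fun m : ℤ => gramTerm p r s m 0 + gramTerm p r s m 1)
    hpos.hasSum (hasSum_gramTerm_neg hlow hup r s)
  exact h.unique htot

theorem hasInfDet_toeplitzGram (hg : ∀ z i j, (g z).1 i j = ev z (p i j))
    (hq : ∀ i j m, starRingEnd ℂ ((p i j).coeff m) = (q j i).coeff (-m))
    (hqp : ∀ i j, q i 0 * p 0 j + q i 1 * p 1 j = if i = j then 1 else 0)
    (hlow : ∀ j m, m < 0 → (p 1 j).coeff m = 0)
    (hup : ∀ j m, m < -(n : ℤ) → (p 0 j).coeff m = 0) :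
    HasInfDet (toeplitzGram g) (Matrix.of fun m l : Fin n => (if m = l then (1 : ℂ) else 0) -
      ∑ k ∈ Finset.range n, ∑ j, (p 0 j).coeff (-((m.val : ℤ) + 1) - k) *
        starRingEnd ℂ ((p 0 j).coeff (-((l.val : ℤ) + 1) - k))).det := by
  -- The finite sections are eventually constant: the columns of `K` with index at least `n` vanish,
  -- so once `S` contains the others, Sylvester's identity gives the same `n × n` determinant.
  refine tendsto_const_nhds.congr' ?_
  filter_upwards [eventually_ge_atTop (Finset.range n ×ˢ (Finset.univ : Finset (Fin 2)))] with S hS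
  let K : Matrix (Fin n) S ℂ := Matrix.of fun m r =>
    (p 0 r.1.2).coeff (-((m.val : ℤ) + 1) - r.1.1)
  have h1 : (toeplitzGram g).submatrix (Subtype.val : S → ℕ × Fin 2) Subtype.val =
      1 + (-Kᴴ) * K := by
    ext r s
    rw [Matrix.submatrix_apply, toeplitzGram_apply hg hq hqp hlow hup, Matrix.add_apply,
      Matrix.neg_mul, Matrix.neg_apply, Matrix.mul_apply, sub_eq_add_neg]
    congr 1
    simp only [Matrix.one_apply, Subtype.ext_iff]
  rw [sectionDet, h1, Matrix.det_one_add_mul_comm]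
  congr 1
  ext m l
  rw [Matrix.of_apply, Matrix.add_apply, Matrix.mul_neg, Matrix.neg_apply, Matrix.mul_apply,
    Matrix.one_apply, sub_eq_add_neg]
  congr 2
  rw [← Finset.sum_product', Finset.sum_subset hS, ← Finset.sum_coe_sort]
  · rfl
  · rintro ⟨k, j⟩ _ hk
    simp only [Finset.mem_product, Finset.mem_range, Finset.mem_univ, and_true, not_lt] at hk
    rw [hup _ _ (by simp only; omega), zero_mul]

theorem absSigma0_sq {d : ℝ} (h : HasInfDet (toeplitzGram g) (d : ℂ)) (hd : 0 ≤ d) :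
    absSigma0 g ^ 2 = d := by
  rw [absSigma0, infDet, Tendsto.limUnder_eq h, Complex.ofReal_re, Real.sq_sqrt hd]

end Gram

/-! ### The determinant of `1 - K K*` -/

theorem coeff_scat_upper_support (ζ : Fin n → ℂ) (m : ℤ) (hm : m < -(n : ℤ)) :
    (scat n ζ 0 0).coeff m = 0 ∧ (scat n ζ 0 1).coeff m = 0 := by
  have h := conj_coeff_scat n ζ m
  rw [(coeff_scat_support n ζ _).1 (by omega), (coeff_scat_support n ζ _).2 (by omega)] at h
  simpa using h

/-- The products of the coefficients of index `-m` and `-l` of the first row, summed over the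
row. -/
def rowProd (ζ : Fin n → ℂ) (m l : ℤ) : ℂ :=
  (scat n ζ 0 0).coeff (-m) * starRingEnd ℂ ((scat n ζ 0 0).coeff (-l)) +
    (scat n ζ 0 1).coeff (-m) * starRingEnd ℂ ((scat n ζ 0 1).coeff (-l))

/-- The kernel of `1 - K K*`, up to the factor `tsq ζ`. -/
def defect (ζ : Fin n → ℂ) (m l : ℕ) : ℂ :=
  (if m = l then (tsq ζ : ℂ) else 0) -
    ∑ k ∈ Finset.range n, rowProd ζ ((m : ℤ) + 1 + k) ((l : ℤ) + 1 + k)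

theorem rowProd_eq_zero (ζ : Fin n → ℂ) (m l : ℤ) (hm : (n : ℤ) < m) : rowProd ζ m l = 0 := by
  rw [rowProd, (coeff_scat_upper_support ζ (-m) (by omega)).1,
    (coeff_scat_upper_support ζ (-m) (by omega)).2, zero_mul, zero_mul, add_zero]

/-- The products of the coefficients of the upper right entry. -/
def cornerProd (ζ : Fin n → ℂ) (m l : ℤ) : ℂ :=
  (scat n ζ 0 1).coeff (-m) * starRingEnd ℂ ((scat n ζ 0 1).coeff (-l))

/-- Right multiplication by the first factor multiplies row inner products by `1 + |ζ 0|²`; the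
index shift in the corner term comes from the factor `z^{-1}` in the upper right entry. -/
theorem rowProd_succ (ζ : Fin (n + 1) → ℂ) (m l : ℤ) :
    (scat (n + 1) ζ 0 0).coeff (-m) * starRingEnd ℂ ((scat (n + 1) ζ 0 0).coeff (-l)) +
      cornerProd ζ (m + 1) (l + 1) =
    (1 + ζ 0 * starRingEnd ℂ (ζ 0)) * rowProd (Fin.tail ζ) m l := by
  simp only [rowProd, cornerProd, coeff_scat_succ_00, coeff_scat_succ_01, map_sub, map_add, map_mul,
    Complex.conj_conj, neg_add, neg_add_cancel_right]
  ring

theorem sum_rowProd_succ (ζ : Fin (n + 1) → ℂ) (m l : ℕ) :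
    ∑ k ∈ Finset.range n, ((scat (n + 1) ζ 0 0).coeff (-((m : ℤ) + 1 + k)) *
        starRingEnd ℂ ((scat (n + 1) ζ 0 0).coeff (-((l : ℤ) + 1 + k))) +
      cornerProd ζ ((m : ℤ) + 1 + k + 1) ((l : ℤ) + 1 + k + 1)) =
    (1 + ζ 0 * starRingEnd ℂ (ζ 0)) *
      ((if m = l then (tsq (Fin.tail ζ) : ℂ) else 0) - defect (Fin.tail ζ) m l) := by
  simp only [rowProd_succ, defect, sub_sub_cancel, Finset.mul_sum]

theorem defect_add_cornerProd (ζ : Fin (n + 1) → ℂ) (m l : ℕ) :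
    defect ζ m l + cornerProd ζ ((m : ℤ) + 1) ((l : ℤ) + 1) =
      (1 + ζ 0 * starRingEnd ℂ (ζ 0)) * defect (Fin.tail ζ) m l := by
  have hs : ∑ k ∈ Finset.range (n + 1), rowProd ζ ((m : ℤ) + 1 + k) ((l : ℤ) + 1 + k) =
      (1 + ζ 0 * starRingEnd ℂ (ζ 0)) *
        ((if m = l then (tsq (Fin.tail ζ) : ℂ) else 0) - defect (Fin.tail ζ) m l) +
      cornerProd ζ ((m : ℤ) + 1) ((l : ℤ) + 1) := by
    rw [← sum_rowProd_succ, Finset.sum_add_distrib]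
    simp only [rowProd, Finset.sum_add_distrib]
    rw [add_assoc]
    congr 1
    · rw [Finset.sum_range_succ, coeff_scat_succ_00,
        (coeff_scat_upper_support (Fin.tail ζ) _ (by omega)).1,
        (coeff_scat_upper_support (Fin.tail ζ) _ (by omega)).2, mul_zero, sub_zero,
        zero_mul, add_zero]
    · rw [Finset.sum_range_succ']
      congr 1
  rw [defect, hs, ofReal_tsq_succ]
  split_ifs <;> ring

/-- Displacement structure: a diagonal shift of the indices makes the sum telescope, and its far end
vanishes because the upper row has no modes below `-n`. -/
theorem defect_succ_succ (ζ : Fin n → ℂ) (m l : ℕ) :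
    defect ζ (m + 1) (l + 1) = defect ζ m l + rowProd ζ ((m : ℤ) + 1) ((l : ℤ) + 1) := by
  have h := Finset.sum_range_succ
    (fun k : ℕ => rowProd ζ ((m : ℤ) + 1 + k) ((l : ℤ) + 1 + k)) n
  rw [Finset.sum_range_succ', rowProd_eq_zero ζ ((m : ℤ) + 1 + n) _ (by omega)] at h
  simp only [defect, add_left_inj]
  rw [add_zero, Nat.cast_zero, add_zero, add_zero] at h
  rw [← h, sub_add, add_sub_cancel_right]
  congr 1
  refine Finset.sum_congr rfl fun k _ => ?_
  push_cast
  congr 1 <;> ring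

theorem coeff_scat_upper_zero (ζ : Fin n → ℂ) :
    (scat n ζ 0 0).coeff 0 = 1 ∧ (scat n ζ 0 1).coeff 0 = 0 := by
  have h := conj_coeff_scat n ζ 0
  rw [neg_zero, coeff_scat_11_zero, (coeff_scat_support n ζ 0).2 (by simp)] at h
  refine ⟨?_, by simpa using h.2⟩
  simpa using congrArg (starRingEnd ℂ) h.1

theorem defect_zero (n : ℕ) (ζ : Fin n → ℂ) (l : ℕ) :
    defect ζ 0 l = starRingEnd ℂ ((scat n ζ 0 0).coeff (-(l : ℤ))) := by
  induction n with
  | zero => simp [defect, tsq, scat_zero, coeff_one, apply_ite (starRingEnd ℂ), eq_comm]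
  | succ n ih =>
    have h := defect_add_cornerProd ζ 0 l
    have h0 := coeff_scat_upper_zero (Fin.tail ζ)
    rw [ih, cornerProd, coeff_scat_succ_01, coeff_scat_succ_01] at h
    simp only [Nat.cast_zero, zero_add, neg_add_cancel, h0.1, h0.2, neg_add,
      neg_add_cancel_right, map_add, map_mul, mul_one, add_zero] at h
    rw [coeff_scat_succ_00, map_sub, map_mul, Complex.conj_conj]
    linear_combination h

theorem defect_comm (ζ : Fin n → ℂ) (m l : ℕ) :
    defect ζ m l = starRingEnd ℂ (defect ζ l m) := by
  simp only [defect, rowProd, map_sub, map_sum, map_add, map_mul, Complex.conj_conj,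
    apply_ite (starRingEnd ℂ), map_zero, Complex.conj_ofReal, eq_comm (a := m)]
  simp only [mul_comm]

/-- `defect_succ_succ` and `defect_add_cornerProd` together express the entry at `(m + 1, l + 1)` as
a product of two upper left coefficients plus `1 + |ζ 0|²` times the kernel of the tail. By
`defect_zero` that product is the rank-one term removed by clearing the first column, so the Schur
complement of the corner `1 / tsq ζ` is exactly the normalized matrix of the tail. -/
theorem det_defect (n : ℕ) (ζ : Fin n → ℂ) :
    (Matrix.of fun m l : Fin n => defect ζ m l / tsq ζ).det =
      ((∏ j : Fin n, 1 / (1 + ‖ζ j‖ ^ 2) ^ (j.val + 1) : ℝ) : ℂ) := by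
  induction n with
  | zero => simp
  | succ n ih =>
    set A : Matrix (Fin (n + 1)) (Fin (n + 1)) ℂ :=
      Matrix.of fun m l => defect ζ m l / tsq ζ with hA
    let B : Matrix (Fin (n + 1)) (Fin (n + 1)) ℂ := Matrix.of fun m l =>
      Fin.cases (A 0 l) (fun m' => A m'.succ l - (scat (n + 1) ζ 0 0).coeff (-(m'.succ.val : ℤ)) *
        A 0 l) m
    have hAB : A.det = B.det := by
      refine Matrix.det_eq_of_forall_row_eq_smul_add_const
        (fun m => Fin.cases 0 (fun m' => (scat (n + 1) ζ 0 0).coeff (-(m'.succ.val : ℤ))) m)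
        0 rfl fun m l => ?_
      refine Fin.cases ?_ (fun m' => ?_) m <;> simp [B]
    have hcol : ∀ m : Fin n, B m.succ 0 = 0 := fun m => by
      simp only [B, hA, Matrix.of_apply, Fin.cases_succ, Fin.val_zero]
      rw [defect_comm, defect_zero, defect_zero, Complex.conj_conj, Nat.cast_zero, neg_zero,
        (coeff_scat_upper_zero ζ).1, map_one]
      ring
    have h00 : B 0 0 = 1 / tsq ζ := by
      simp only [B, hA, Matrix.of_apply, Fin.cases_zero, Fin.val_zero]
      rw [defect_zero, Nat.cast_zero, neg_zero, (coeff_scat_upper_zero ζ).1, map_one]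
    have hsub : B.submatrix Fin.succ Fin.succ =
        Matrix.of fun m l : Fin n => defect (Fin.tail ζ) m l / tsq (Fin.tail ζ) := by
      ext m l
      simp only [B, hA, Matrix.of_apply, Matrix.submatrix_apply, Fin.cases_succ, Fin.val_zero,
        Fin.val_succ]
      have h1 := defect_add_cornerProd ζ m l
      have h2 := defect_succ_succ ζ m l
      rw [rowProd] at h2
      rw [cornerProd] at h1
      rw [defect_zero]
      have ht := tsq_ne_zero ζ
      have ht' := tsq_ne_zero (Fin.tail ζ)
      have hts := ofReal_tsq_succ ζ
      push_cast
      rw [eq_div_iff ht', ← mul_div_assoc, ← sub_div, div_mul_eq_mul_div, div_eq_iff ht, hts]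
      linear_combination (tsq (Fin.tail ζ) : ℂ) * (h2 + h1)
    rw [hAB, Matrix.det_succ_column_zero, Fin.sum_univ_succ]
    simp only [hcol, mul_zero, zero_mul, Finset.sum_const_zero, add_zero, Fin.val_zero, pow_zero,
      one_mul, h00]
    have : (Fin.succAbove (0 : Fin (n + 1))) = Fin.succ := by
      ext i
      simp
    rw [this, hsub, ih, ← Complex.ofReal_one, ← Complex.ofReal_div, ← Complex.ofReal_mul]
    congr 1
    rw [tsq, one_div, ← Finset.prod_inv_distrib, Fin.prod_univ_succ,
      Fin.prod_univ_succ (fun j : Fin (n + 1) => 1 / _ ^ (j.val + 1)), mul_assoc,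
      ← Finset.prod_mul_distrib]
    simp [Fin.tail, pow_succ _ (_ + 1)]

/-! ### Holomorphic functions agreeing on the circle -/

theorem frequently_mem_sphere {z : ℂ} (hz : ‖z‖ = 1) : ∃ᶠ w in 𝓝[≠] z, ‖w‖ = 1 := by
  have hpre : Preperfect (Metric.sphere (0 : ℂ) 1) := by
    refine IsPreconnected.preperfect_of_nontrivial ⟨1, by simp, -1, by simp, ?_⟩
      (isPreconnected_sphere (by rw [Complex.rank_real_complex]; norm_num) 0 1)
    intro h
    have := congrArg Complex.re h
    norm_num at this
  have := accPt_iff_frequently_nhdsNE.1 (hpre z (by simpa using hz))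
  simpa using this

/-- The function on the disk and the one on its exterior glue to a bounded entire function, which
Liouville's theorem makes constant. -/
theorem eq_apply_zero_of_eq_inv {F G : ℂ → ℂ} (hF : AnalyticOnNhd ℂ F (Metric.closedBall 0 1))
    (hG : AnalyticOnNhd ℂ G (Metric.closedBall 0 1))
    (h : ∀ z : Circle, F z = G ((z : ℂ)⁻¹)) (z : Circle) : F z = F 0 := by
  classical
  let H : ℂ → ℂ := fun w => if ‖w‖ ≤ 1 then F w else G w⁻¹
  have hFa : ∀ w, ‖w‖ ≤ 1 → AnalyticAt ℂ F w := fun w hw => hF w (by simpa using hw)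
  have hGa : ∀ w, 1 ≤ ‖w‖ → AnalyticAt ℂ (fun w => G w⁻¹) w := fun w hw => by
    have hw0 : w ≠ 0 := by
      rintro rfl
      norm_num at hw
    refine AnalyticAt.fun_comp (hG _ ?_) (analyticAt_inv hw0)
    simpa using inv_le_one_of_one_le₀ hw
  have hdiff : Differentiable ℂ H := by
    intro w
    rcases lt_trichotomy ‖w‖ 1 with hw | hw | hw
    · refine (hFa w hw.le).differentiableAt.congr_of_eventuallyEq ?_
      filter_upwards [continuous_norm.continuousAt.eventually_lt continuousAt_const hw] with v hv
      exact if_pos hv.le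
    · have hev : ∀ᶠ v in 𝓝 w, F v = G v⁻¹ := by
        refine ((hFa w hw.le).frequently_eq_iff_eventually_eq (hGa w hw.ge)).1 ?_
        refine (frequently_mem_sphere hw).mono fun v hv => ?_
        exact h ⟨v, mem_sphere_zero_iff_norm.2 hv⟩
      refine (hFa w hw.le).differentiableAt.congr_of_eventuallyEq ?_
      filter_upwards [hev] with v hv
      simp only [H]
      split_ifs
      · rfl
      · exact hv.symm
    · refine (hGa w hw.le).differentiableAt.congr_of_eventuallyEq ?_
      filter_upwards [continuousAt_const.eventually_lt continuous_norm.continuousAt hw] with v hv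
      exact if_neg hv.not_ge
  have hbdd : Bornology.IsBounded (Set.range H) := by
    have hc : IsCompact (Metric.closedBall (0 : ℂ) 1) := isCompact_closedBall 0 1
    refine ((hc.image_of_continuousOn hF.continuousOn).isBounded.union
      (hc.image_of_continuousOn hG.continuousOn).isBounded).subset ?_
    rintro _ ⟨w, rfl⟩
    by_cases hw : ‖w‖ ≤ 1
    · exact Or.inl ⟨w, by simpa using hw, (if_pos hw).symm⟩
    · refine Or.inr ⟨w⁻¹, ?_, (if_neg hw).symm⟩
      simpa using inv_le_one_of_one_le₀ (not_le.1 hw).le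
  have := hdiff.apply_eq_apply_of_bounded hbdd z 0
  rwa [show H z = F z from if_pos z.norm_coe.le, show H 0 = F 0 from if_pos (by simp)] at this

theorem analyticOnNhd_dslope {F : ℂ → ℂ} (hF : AnalyticOnNhd ℂ F (Metric.closedBall 0 1)) :
    AnalyticOnNhd ℂ (dslope F 0) (Metric.closedBall 0 1) := by
  have hU : IsOpen {z | AnalyticAt ℂ F z} := isOpen_analyticAt ℂ F
  have h0 : (0 : ℂ) ∈ {z | AnalyticAt ℂ F z} := hF 0 (by simp)
  have hd : DifferentiableOn ℂ (dslope F 0) {z | AnalyticAt ℂ F z} :=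
    (Complex.differentiableOn_dslope (hU.mem_nhds h0)).2
      fun z hz => hz.differentiableAt.differentiableWithinAt
  exact fun z hz => hd.analyticOnNhd hU z (hF z hz)

theorem eq_add_mul_dslope (F : ℂ → ℂ) (z : ℂ) : F z = F 0 + z * dslope F 0 z := by
  have := sub_smul_dslope F 0 z
  rw [sub_zero, smul_eq_mul] at this
  rw [this]
  ring

/-- Subtracting `z^{n+1} G(0)` from `F` and replacing `G` by its slope at `0` lowers the exponent by
one; exponent zero is the Liouville case. -/
theorem exists_coeff_of_eq_pow_mul (n : ℕ) {F G : ℂ → ℂ}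
    (hF : AnalyticOnNhd ℂ F (Metric.closedBall 0 1))
    (hG : AnalyticOnNhd ℂ G (Metric.closedBall 0 1))
    (h : ∀ z : Circle, F z = (z : ℂ) ^ n * G ((z : ℂ)⁻¹)) :
    ∃ x : Fin n → ℂ, ∀ z : Circle,
      G ((z : ℂ)⁻¹) = G 0 + ∑ j : Fin n, x j * ((z : ℂ)⁻¹) ^ (j.val + 1) := by
  induction n generalizing F G with
  | zero =>
    refine ⟨Fin.elim0, fun z => ?_⟩
    have := eq_apply_zero_of_eq_inv hG hF (fun z => by
      have := h z⁻¹
      rw [Circle.coe_inv] at this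
      simp [this]) z⁻¹
    simpa using this
  | succ n ih =>
    have hF' : AnalyticOnNhd ℂ (fun z => F z - z ^ (n + 1) * G 0) (Metric.closedBall 0 1) :=
      fun z hz => (hF z hz).sub
        ((show Differentiable ℂ fun z : ℂ => z ^ (n + 1) * G 0 by fun_prop).analyticAt z)
    obtain ⟨x, hx⟩ := ih hF' (analyticOnNhd_dslope hG) fun z => by
      have hz := z.coe_ne_zero
      rw [h z, eq_add_mul_dslope G (z : ℂ)⁻¹]
      field_simp
      ring
    refine ⟨Fin.cons (dslope G 0 0) x, fun z => ?_⟩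
    rw [eq_add_mul_dslope G (z : ℂ)⁻¹, hx z, Fin.sum_univ_succ]
    simp only [Fin.cons_zero, Fin.cons_succ, Fin.val_zero, Fin.val_succ, zero_add, pow_one,
      mul_add, Finset.mul_sum]
    congr 1
    rw [mul_comm]
    congr 1
    exact Finset.sum_congr rfl fun j _ => by ring

/-! ### Conjugation by the Weyl group representatives -/

theorem coe_conj_s0 (u : Loop) (z : Circle) : ((s0⁻¹ * u * s0) z).1 =
    !![(u z).1 1 1, (u z).1 1 0 * ((z : ℂ)⁻¹) ^ 2; (u z).1 0 1 * (z : ℂ) ^ 2, (u z).1 0 0] := by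
  have hz := z.coe_ne_zero
  have h : ((s0⁻¹ * u * s0) z).1 = (s0 z).1.adjugate * (u z).1 * (s0 z).1 := rfl
  rw [h, s0, Matrix.adjugate_fin_two_of, Matrix.eta_fin_two (u z).1]
  ext i j
  fin_cases i <;> fin_cases j <;> simp [Matrix.mul_apply, Fin.sum_univ_two] <;>
    field_simp <;> simp

theorem coe_conj_s1 (u : Loop) (z : Circle) : ((s1⁻¹ * u * s1) z).1 =
    !![(u z).1 1 1, (u z).1 1 0; (u z).1 0 1, (u z).1 0 0] := by
  have h : ((s1⁻¹ * u * s1) z).1 = (s1 z).1.adjugate * (u z).1 * (s1 z).1 := rfl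
  rw [h, s1, Matrix.adjugate_fin_two_of, Matrix.eta_fin_two (u z).1]
  ext i j
  fin_cases i <;> fin_cases j <;> simp [Matrix.mul_apply, Fin.sum_univ_two] <;>
    linear_combination (-(u z).1 _ _) * Complex.I_mul_I

theorem weyl_odd (k : ℕ) : weyl (2 * k + 1) = s0 * weyl (2 * k) := by
  rw [weyl, if_pos (by simp)]

theorem weyl_even (k : ℕ) : weyl (2 * (k + 1)) = s1 * weyl (2 * k + 1) :=
  congrArg (· * _) (if_neg (by simp : ¬ Even (2 * k + 1)))

/-- Conjugation by `s₁ s₀` is a translation in the affine Weyl group: it keeps the diagonal and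
multiplies the off-diagonal entries by `z^{∓2}`. -/
theorem coe_conj_weyl_two_mul (k : ℕ) (u : Loop) (z : Circle) :
    (((weyl (2 * k))⁻¹ * u * weyl (2 * k)) z).1 =
      !![(u z).1 0 0, (u z).1 0 1 * ((z : ℂ)⁻¹) ^ (2 * k);
        (u z).1 1 0 * (z : ℂ) ^ (2 * k), (u z).1 1 1] := by
  induction k generalizing u with
  | zero => simp [weyl, ← Matrix.eta_fin_two]
  | succ k ih =>
    have : (weyl (2 * (k + 1)))⁻¹ * u * weyl (2 * (k + 1)) =
        (weyl (2 * k))⁻¹ * (s0⁻¹ * (s1⁻¹ * u * s1) * s0) * weyl (2 * k) := by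
      rw [weyl_even, weyl_odd]
      group
    rw [this, ih, coe_conj_s0, coe_conj_s1]
    ext i j
    fin_cases i <;> fin_cases j <;> simp <;> ring

theorem coe_conj_weyl_even {n k : ℕ} (hn : n = 2 * k) (u : Loop) (z : Circle) :
    (((weyl n)⁻¹ * u * weyl n) z).1 =
      !![(u z).1 0 0, (u z).1 0 1 * ((z : ℂ)⁻¹) ^ n; (u z).1 1 0 * (z : ℂ) ^ n, (u z).1 1 1] := by
  subst hn
  exact coe_conj_weyl_two_mul k u z

theorem coe_conj_weyl_odd {n k : ℕ} (hn : n = 2 * k + 1) (u : Loop) (z : Circle) :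
    (((weyl n)⁻¹ * u * weyl n) z).1 =
      !![(u z).1 1 1, (u z).1 1 0 * ((z : ℂ)⁻¹) ^ (n + 1);
        (u z).1 0 1 * (z : ℂ) ^ (n + 1), (u z).1 0 0] := by
  subst hn
  have : (weyl (2 * k + 1))⁻¹ * u * weyl (2 * k + 1) =
      (weyl (2 * k))⁻¹ * (s0⁻¹ * u * s0) * weyl (2 * k) := by
    rw [weyl_odd]
    group
  rw [this, coe_conj_weyl_two_mul, coe_conj_s0]
  ext i j
  fin_cases i <;> fin_cases j <;> simp <;> ring

/-! ### The group `N⁻ ∩ w_n⁻¹ N⁺ w_n` -/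

theorem exists_analytic_conj_weyl (n : ℕ) {u : Loop} (hu : u ∈ Nplus) :
    ∃ a b c d : ℂ → ℂ, AnalyticOnNhd ℂ a (Metric.closedBall 0 1) ∧
      AnalyticOnNhd ℂ b (Metric.closedBall 0 1) ∧ AnalyticOnNhd ℂ c (Metric.closedBall 0 1) ∧
      AnalyticOnNhd ℂ d (Metric.closedBall 0 1) ∧ a 0 = 1 ∧ d 0 = 1 ∧
      ∀ z : Circle, (((weyl n)⁻¹ * u * weyl n) z).1 =
        !![a z, b z * ((z : ℂ)⁻¹) ^ n; c z * (z : ℂ) ^ n, d z] := by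
  obtain ⟨F, hF, -, h00, h10, h11, hu⟩ := hu
  rcases Nat.even_or_odd' n with ⟨k, hk | hk⟩
  · refine ⟨_, _, _, _, hF 0 0, hF 0 1, hF 1 0, hF 1 1, h00, h11, fun z => ?_⟩
    rw [coe_conj_weyl_even hk, hu]
  -- For odd `n` the entries are swapped and the exponent is `n + 1`. The zero of the lower left
  -- entry at the origin absorbs one power, and the upper right entry takes an extra factor `z`, so
  -- both parities have the same shape.
  · refine ⟨_, _, _, _, hF 1 1, analyticOnNhd_dslope (hF 1 0),
      fun z hz => (hF 0 1 z hz).mul analyticAt_id, hF 0 0, h11, h00, fun z => ?_⟩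
    rw [coe_conj_weyl_odd hk, hu]
    have hz := z.coe_ne_zero
    have h := eq_add_mul_dslope (fun z => F z 1 0) z
    simp only [h10, zero_add] at h
    rw [h]
    ext i j
    fin_cases i <;> fin_cases j <;> simp
    · rw [pow_succ]
      field_simp
    · ring

theorem eq_unip_of_mem_Ncell {n : ℕ} (hn : 0 < n) {l : Loop} (hl : l ∈ Ncell n) :
    ∃ x : Fin n → ℂ, l = unip x := by
  obtain ⟨⟨G, hG, -, -, hG01, -, hGl⟩, u, hu, rfl⟩ := hl
  obtain ⟨a, b, c, d, ha, hb, hc, hd, ha0, hd0, hF⟩ := exists_analytic_conj_weyl n hu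
  have hcn : AnalyticOnNhd ℂ (fun z => c z * z ^ n) (Metric.closedBall 0 1) := fun z hz =>
    (hc z hz).mul ((show Differentiable ℂ fun z : ℂ => z ^ n by fun_prop).analyticAt z)
  have hE : ∀ (z : Circle) i j, !![a z, b z * ((z : ℂ)⁻¹) ^ n; c z * (z : ℂ) ^ n, d z] i j =
      G ((z : ℂ)⁻¹) i j := fun z i j => by
    rw [← hF, ← hGl]
  obtain ⟨x, hx⟩ := exists_coeff_of_eq_pow_mul n hb (hG 0 1) fun z => by
    have hz := z.coe_ne_zero
    rw [← hE z 0 1]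
    simp
    field_simp
  refine ⟨x, funext fun z => Subtype.ext ?_⟩
  rw [hF]
  have h00 := eq_apply_zero_of_eq_inv ha (hG 0 0) (fun z => hE z 0 0) z
  have h11 := eq_apply_zero_of_eq_inv hd (hG 1 1) (fun z => hE z 1 1) z
  have h10 := eq_apply_zero_of_eq_inv hcn (hG 1 0) (fun z => hE z 1 0) z
  have h01 := hE z 0 1
  rw [hx, hG01, zero_add] at h01
  simp only [zero_pow hn.ne', mul_zero] at h10
  simp only [Matrix.of_apply, Matrix.cons_val_zero, Matrix.cons_val_one, Matrix.cons_val'] at h01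
  rw [h00, h11, h10, h01, ha0, hd0]
  rfl

theorem unip_mem_Ncell {n : ℕ} (x : Fin n → ℂ) : unip x ∈ Ncell n := by
  refine ⟨⟨fun y => !![1, ∑ j : Fin n, x j * y ^ (j.val + 1); 0, 1], fun i j => ?_, ?_, rfl, ?_,
    rfl, fun z => rfl⟩, ?_⟩
  · refine fun y _ => Differentiable.analyticAt ?_ y
    fin_cases i <;> fin_cases j <;> simp <;> fun_prop
  · intro y _
    simp [Matrix.det_fin_two_of]
  · simp
  · rcases Nat.even_or_odd' n with ⟨k, hk | hk⟩
    · refine ⟨fun z => ⟨!![1, ∑ j : Fin n, x j * (z : ℂ) ^ (n - (j.val + 1)); 0, 1], by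
        simp [Matrix.det_fin_two_of]⟩, ⟨fun z => !![1, ∑ j : Fin n, x j * z ^ (n - (j.val + 1)); 0, 1],
        fun i j => ?_, ?_, rfl, rfl, rfl, fun z => rfl⟩, ?_⟩
      · refine fun y _ => Differentiable.analyticAt ?_ y
        fin_cases i <;> fin_cases j <;> simp <;> fun_prop
      · intro y _
        simp [Matrix.det_fin_two_of]
      · refine funext fun z => Subtype.ext ?_
        have hz := z.coe_ne_zero
        refine (coe_conj_weyl_even hk _ z).trans ?_
        rw [unip]
        simp only [Matrix.of_apply, Matrix.cons_val_zero, Matrix.cons_val_one, Matrix.cons_val',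
          zero_mul, Finset.sum_mul]
        have hs : ∑ j : Fin n, x j * (z : ℂ) ^ (n - (j.val + 1)) * ((z : ℂ)⁻¹) ^ n =
            ∑ j : Fin n, x j * ((z : ℂ)⁻¹) ^ (j.val + 1) :=
          Finset.sum_congr rfl fun j _ => by
            rw [pow_sub₀ _ hz (show j.val + 1 ≤ n from j.2), inv_pow, inv_pow]
            field_simp
        rw [hs]
    -- Here the preimage in `N⁺` is lower triangular; all exponents `n - j` are positive, so its
    -- value at `0` is still the identity.
    · refine ⟨fun z => ⟨!![1, 0; ∑ j : Fin n, x j * (z : ℂ) ^ (n - j.val), 1], by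
        simp [Matrix.det_fin_two_of]⟩, ⟨fun z => !![1, 0; ∑ j : Fin n, x j * z ^ (n - j.val), 1],
        fun i j => ?_, ?_, rfl, ?_, rfl, fun z => rfl⟩, ?_⟩
      · refine fun y _ => Differentiable.analyticAt ?_ y
        fin_cases i <;> fin_cases j <;> simp <;> fun_prop
      · intro y _
        simp [Matrix.det_fin_two_of]
      · simp only [Matrix.of_apply, Matrix.cons_val_zero, Matrix.cons_val_one, Matrix.cons_val']
        refine Finset.sum_eq_zero fun j _ => ?_
        rw [zero_pow (Nat.sub_ne_zero_of_lt j.2), mul_zero]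
      · refine funext fun z => Subtype.ext ?_
        have hz := z.coe_ne_zero
        refine (coe_conj_weyl_odd hk _ z).trans ?_
        rw [unip]
        simp only [Matrix.of_apply, Matrix.cons_val_zero, Matrix.cons_val_one, Matrix.cons_val',
          zero_mul, Finset.sum_mul]
        have hs : ∑ j : Fin n, x j * (z : ℂ) ^ (n - j.val) * ((z : ℂ)⁻¹) ^ (n + 1) =
            ∑ j : Fin n, x j * ((z : ℂ)⁻¹) ^ (j.val + 1) :=
          Finset.sum_congr rfl fun j _ => by
            rw [pow_sub₀ _ hz j.2.le, inv_pow, inv_pow]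
            field_simp
            ring
        rw [hs]

theorem Ncell_eq {n : ℕ} (hn : 0 < n) : Ncell n = {l | ∃ x : Fin n → ℂ, l = unip x} := by
  ext l
  refine ⟨eq_unip_of_mem_Ncell hn, ?_⟩
  rintro ⟨x, rfl⟩
  exact unip_mem_Ncell x

/-! ### The entries of the loop `g_ζ` -/

theorem coe_kMat (ζ : ℂ) : (kMat ζ).1 =
    (aCoef ζ : ℂ) • !![1, -(starRingEnd ℂ ζ); ζ, 1] := by
  have ha : (aCoef ζ : ℂ) ≠ 0 := by exact_mod_cast (aCoef_pos ζ).ne'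
  have h2 : (aCoef ζ : ℂ) ^ 2 * (1 + ζ * starRingEnd ℂ ζ) = 1 := by
    rw [Complex.mul_conj', aCoef]
    norm_cast
    rw [inv_pow, Real.sq_sqrt (by positivity)]
    exact inv_mul_cancel₀ (by positivity)
  have h : (kMat ζ).1 = !![1, 0; ζ, 1] * !![(aCoef ζ : ℂ), 0; 0, (aCoef ζ : ℂ)⁻¹] *
    !![1, -(starRingEnd ℂ ζ); 0, 1] := rfl
  rw [h]
  ext i j
  fin_cases i <;> fin_cases j <;> simp [Matrix.mul_apply, Fin.sum_univ_two]
  · ring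
  · field_simp
    linear_combination -h2

theorem coe_factor (j : ℕ) (ζ : ℂ) (z : Circle) :
    (((weyl j)⁻¹ * rootHom j (kMat ζ) * weyl j) z).1 = (aCoef ζ : ℂ) •
      !![1, ζ * ((z : ℂ)⁻¹) ^ (j + 1); -(starRingEnd ℂ ζ) * (z : ℂ) ^ (j + 1), 1] := by
  rcases Nat.even_or_odd' j with ⟨k, hk | hk⟩
  · rw [coe_conj_weyl_even hk, rootHom, if_pos (by simp [hk])]
    simp only [rootHom0, coe_kMat]
    ext i l
    fin_cases i <;> fin_cases l <;> simp <;> ring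
  · rw [coe_conj_weyl_odd hk, rootHom, if_neg (by simp [hk])]
    simp only [rootHom1, coe_kMat]
    ext i l
    fin_cases i <;> fin_cases l <;> simp <;> ring

/-- The offset `s` is needed for the induction: the factors of the tail are conjugated by Weyl
elements one step further on, which only multiplies the off-diagonal entries by powers of `z`. -/
theorem coe_prod_factor (n s : ℕ) (ζ : Fin n → ℂ) (z : Circle) :
    ((List.ofFn fun j : Fin n => (weyl (j + s))⁻¹ * rootHom (j + s) (kMat (ζ j)) *
      weyl (j + s)).reverse.prod z).1 = ((∏ j, aCoef (ζ j) : ℝ) : ℂ) •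
        !![ev z (scat n ζ 0 0), ((z : ℂ)⁻¹) ^ s * ev z (scat n ζ 0 1);
          (z : ℂ) ^ s * ev z (scat n ζ 1 0), ev z (scat n ζ 1 1)] := by
  induction n generalizing s with
  | zero => simp [scat_zero, ← Matrix.one_fin_two]
  | succ n ih =>
    have hz := z.coe_ne_zero
    have h := ih (s + 1) (Fin.tail ζ)
    rw [List.ofFn_succ, List.reverse_cons, List.prod_append, List.prod_singleton]
    have hs : (fun j : Fin n => (weyl (j.succ + s))⁻¹ * rootHom (j.succ + s) (kMat (ζ j.succ)) *
        weyl (j.succ + s)) = fun j : Fin n => (weyl (j + (s + 1)))⁻¹ *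
          rootHom (j + (s + 1)) (kMat (Fin.tail ζ j)) * weyl (j + (s + 1)) := by
      ext1 j
      rw [Fin.val_succ, add_assoc, add_comm 1 s]
      rfl
    rw [hs, Pi.mul_apply, Matrix.SpecialLinearGroup.coe_mul]
    erw [h]
    rw [coe_factor, Fin.prod_univ_succ, scat_succ_00, scat_succ_01, scat_succ_10, scat_succ_11]
    simp only [map_sub, map_add, map_mul, ev_C, ev_T, zpow_neg_one, zpow_one, Fin.val_zero, zero_add,
      Complex.ofReal_mul, Fin.tail, Matrix.smul_mul, Matrix.mul_smul, smul_smul]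
    rw [mul_comm (aCoef (ζ 0) : ℂ)]
    congr 1
    ext i j
    fin_cases i <;> fin_cases j <;>
      simp [Matrix.mul_apply, Fin.sum_univ_two, pow_succ] <;> field_simp <;> ring

/-- The product of the numbers `a(ζ_j)`. -/
def aProd {n : ℕ} (ζ : Fin n → ℂ) : ℝ := ∏ j, aCoef (ζ j)

theorem aProd_pos (ζ : Fin n → ℂ) : 0 < aProd ζ := Finset.prod_pos fun _ _ => aCoef_pos _

theorem aProd_sq (ζ : Fin n → ℂ) : aProd ζ ^ 2 = (tsq ζ)⁻¹ := by
  rw [aProd, ← Finset.prod_pow, tsq, ← Finset.prod_inv_distrib]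
  refine Finset.prod_congr rfl fun j _ => ?_
  rw [aCoef, inv_pow, Real.sq_sqrt (by positivity)]

theorem ofReal_aProd_sq (ζ : Fin n → ℂ) : (aProd ζ : ℂ) ^ 2 * tsq ζ = 1 := by
  rw [← Complex.ofReal_pow, aProd_sq, Complex.ofReal_inv, inv_mul_cancel₀ (tsq_ne_zero ζ)]

theorem gLoop_apply (n : ℕ) (ζ : Fin n → ℂ) (z : Circle) (i j : Fin 2) :
    (gLoop n ζ z).1 i j = ev z (C (aProd ζ : ℂ) * scat n ζ i j) := by
  have h := congrFun (congrFun (coe_prod_factor n 0 ζ z) i) j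
  simp only [add_zero, pow_zero, one_mul] at h
  rw [gLoop, h, map_mul, ev_C]
  fin_cases i <;> fin_cases j <;> rfl

theorem conj_ev_scat (n : ℕ) (ζ : Fin n → ℂ) (z : Circle) :
    starRingEnd ℂ (ev z (scat n ζ 0 0)) = ev z (scat n ζ 1 1) ∧
      starRingEnd ℂ (ev z (scat n ζ 0 1)) = -ev z (scat n ζ 1 0) := by
  induction n with
  | zero => simp [scat_zero]
  | succ n ih =>
    obtain ⟨h1, h2⟩ := ih (Fin.tail ζ)
    have hz : starRingEnd ℂ ((z : ℂ)⁻¹) = z := by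
      rw [← Circle.coe_inv, ← Circle.coe_inv_eq_conj, inv_inv]
    rw [scat_succ_00, scat_succ_01, scat_succ_10, scat_succ_11]
    simp only [map_sub, map_add, map_mul, ev_C, ev_T, zpow_neg_one, zpow_one, h1, h2,
      Complex.conj_conj, hz]
    constructor <;> ring

theorem gLoop_mem_specialUnitaryGroup (n : ℕ) (ζ : Fin n → ℂ) (z : Circle) :
    (gLoop n ζ z).1 ∈ Matrix.specialUnitaryGroup (Fin 2) ℂ := by
  rw [Matrix.mem_specialUnitaryGroup_iff]
  refine ⟨?_, (gLoop n ζ z).2⟩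
  rw [Matrix.mem_unitaryGroup_iff']
  obtain ⟨h1, h2⟩ := conj_ev_scat n ζ z
  have h3 := congrArg (starRingEnd ℂ) h1
  have h4 := congrArg (starRingEnd ℂ) h2
  rw [Complex.conj_conj] at h3
  rw [map_neg, Complex.conj_conj] at h4
  have hd := (gLoop n ζ z).2
  rw [Matrix.det_fin_two] at hd
  simp only [gLoop_apply, map_mul, ev_C] at hd
  ext i j
  rw [Matrix.mul_apply, Fin.sum_univ_two]
  simp only [Matrix.star_apply, gLoop_apply, map_mul, ev_C, star_mul', RCLike.star_def,
    Complex.conj_ofReal]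
  fin_cases i <;> fin_cases j <;> simp [h3, h4] <;> simp only [h3, h4] at hd
  · linear_combination hd
  · ring
  · ring
  · linear_combination hd

theorem conj_coeff_scat_lower (n : ℕ) (ζ : Fin n → ℂ) (m : ℤ) :
    starRingEnd ℂ ((scat n ζ 1 1).coeff m) = (scat n ζ 0 0).coeff (-m) ∧
      starRingEnd ℂ ((scat n ζ 1 0).coeff m) = -(scat n ζ 0 1).coeff (-m) := by
  obtain ⟨h1, h2⟩ := conj_coeff_scat n ζ (-m)
  rw [neg_neg] at h1 h2
  rw [← h1, Complex.conj_conj, ← Complex.conj_conj ((scat n ζ 0 1).coeff (-m)), h2,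
    map_neg (starRingEnd ℂ), neg_neg]
  exact ⟨rfl, rfl⟩

/-! ### Toeplitz determinants of `g_ζ` -/

/-- The normalized adjugate is the inverse. It is stated for an arbitrary `f` so as to serve both
the loop and its half-conjugate. -/
theorem gLoop_entries (ζ : Fin n → ℂ) (f : Fin 2 → Fin 2 → ℂ[T;T⁻¹])
    (hf : f 0 0 * f 1 1 - f 0 1 * f 1 0 = C (tsq ζ : ℂ)) (i j : Fin 2) :
    !![C (aProd ζ : ℂ) * f 1 1, -(C (aProd ζ : ℂ) * f 0 1);
        -(C (aProd ζ : ℂ) * f 1 0), C (aProd ζ : ℂ) * f 0 0] i 0 * (C (aProd ζ : ℂ) * f 0 j) +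
      !![C (aProd ζ : ℂ) * f 1 1, -(C (aProd ζ : ℂ) * f 0 1);
        -(C (aProd ζ : ℂ) * f 1 0), C (aProd ζ : ℂ) * f 0 0] i 1 * (C (aProd ζ : ℂ) * f 1 j) =
      if i = j then 1 else 0 := by
  have ha : C (aProd ζ : ℂ) ^ 2 * C (tsq ζ : ℂ) = 1 := by
    rw [← map_pow, ← map_mul, ofReal_aProd_sq, map_one]
  fin_cases i <;> fin_cases j <;> simp
  · linear_combination C (aProd ζ : ℂ) ^ 2 * hf + ha
  · ring
  · ring
  · linear_combination C (aProd ζ : ℂ) ^ 2 * hf + ha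

theorem hasInfDet_gLoop (n : ℕ) (ζ : Fin n → ℂ) : HasInfDet (toeplitzGram (gLoop n ζ))
    ((∏ j : Fin n, 1 / (1 + ‖ζ j‖ ^ 2) ^ (j.val + 1) : ℝ) : ℂ) := by
  have h := hasInfDet_toeplitzGram (n := n) (gLoop_apply n ζ)
    (q := fun i j => !![C (aProd ζ : ℂ) * scat n ζ 1 1, -(C (aProd ζ : ℂ) * scat n ζ 0 1);
      -(C (aProd ζ : ℂ) * scat n ζ 1 0), C (aProd ζ : ℂ) * scat n ζ 0 0] i j) ?_
    (gLoop_entries ζ (scat n ζ) (scat_det n ζ)) ?_ ?_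
  · rw [← det_defect]
    convert h using 2
    ext m l
    rw [Matrix.of_apply, Matrix.of_apply, defect, sub_div]
    simp only [Fin.sum_univ_two, coeff_C_mul, map_mul, Complex.conj_ofReal, Fin.ext_iff]
    congr 1
    · split_ifs
      · exact div_self (tsq_ne_zero ζ)
      · exact zero_div _
    · rw [div_eq_iff (tsq_ne_zero ζ), Finset.sum_mul]
      refine Finset.sum_congr rfl fun k _ => ?_
      rw [rowProd, neg_add' _ (k : ℤ), neg_add' _ (k : ℤ)]
      linear_combination (-((scat n ζ 0 0).coeff (-((m.val : ℤ) + 1) - k) *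
        starRingEnd ℂ ((scat n ζ 0 0).coeff (-((l.val : ℤ) + 1) - k)) +
        (scat n ζ 0 1).coeff (-((m.val : ℤ) + 1) - k) *
        starRingEnd ℂ ((scat n ζ 0 1).coeff (-((l.val : ℤ) + 1) - k)))) * ofReal_aProd_sq ζ
  · intro i j m
    have h := conj_coeff_scat n ζ m
    have h' := conj_coeff_scat_lower n ζ m
    fin_cases i <;> fin_cases j <;> simp [coeff_C_mul, h, h']
  · intro j m hm
    have h := coeff_scat_support n ζ m
    rw [coeff_C_mul]
    fin_cases j
    · simp [h.2 (Or.inl (by omega))]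
    · simp [h.1 (Or.inl hm)]
  · intro j m hm
    have h := coeff_scat_upper_support ζ m hm
    rw [coeff_C_mul]
    fin_cases j
    · simp [h.1]
    · simp [h.2]

/-- The entries of `halfConj (gLoop n ζ)`, up to the factor `aProd ζ`. -/
def scatHalf (n : ℕ) (ζ : Fin n → ℂ) : Matrix (Fin 2) (Fin 2) ℂ[T;T⁻¹] :=
  !![scat n ζ 0 0, T 1 * scat n ζ 0 1; T (-1) * scat n ζ 1 0, scat n ζ 1 1]

theorem halfConj_gLoop_apply (n : ℕ) (ζ : Fin n → ℂ) (z : Circle) (i j : Fin 2) :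
    (halfConj (gLoop n ζ) z).1 i j = ev z (C (aProd ζ : ℂ) * scatHalf n ζ i j) := by
  have h : (halfConj (gLoop n ζ) z).1 = !![(gLoop n ζ z).1 0 0, (z : ℂ) * (gLoop n ζ z).1 0 1;
    (z : ℂ)⁻¹ * (gLoop n ζ z).1 1 0, (gLoop n ζ z).1 1 1] := rfl
  rw [h]
  fin_cases i <;> fin_cases j <;> simp [gLoop_apply, scatHalf, ev_C, ev_T] <;> ring

theorem scatHalf_det (n : ℕ) (ζ : Fin n → ℂ) :
    scatHalf n ζ 0 0 * scatHalf n ζ 1 1 - scatHalf n ζ 0 1 * scatHalf n ζ 1 0 =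
      C (tsq ζ : ℂ) := by
  have hT : (T 1 : ℂ[T;T⁻¹]) * T (-1) = 1 := by rw [← T_add]; simp
  rw [← scat_det]
  simp only [scatHalf, Matrix.of_apply, Matrix.cons_val_zero, Matrix.cons_val_one,
    Matrix.cons_val']
  linear_combination -(scat n ζ 0 1 * scat n ζ 1 0) * hT

/-- The half-conjugate is the loop of the tail times a constant unitary matrix, which preserves row
inner products. Thus its `1 - KK*` coincides with that of the tail, of size one less. -/
theorem hasInfDet_halfConj_gLoop (n : ℕ) (ζ : Fin (n + 1) → ℂ) :
    HasInfDet (toeplitzGram (halfConj (gLoop (n + 1) ζ)))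
      ((∏ j : Fin n, 1 / (1 + ‖Fin.tail ζ j‖ ^ 2) ^ (j.val + 1) : ℝ) : ℂ) := by
  have h := hasInfDet_toeplitzGram (n := n) (halfConj_gLoop_apply (n + 1) ζ)
    (q := fun i j => !![C (aProd ζ : ℂ) * scatHalf (n + 1) ζ 1 1,
        -(C (aProd ζ : ℂ) * scatHalf (n + 1) ζ 0 1);
      -(C (aProd ζ : ℂ) * scatHalf (n + 1) ζ 1 0), C (aProd ζ : ℂ) * scatHalf (n + 1) ζ 0 0] i j) ?_
    (gLoop_entries ζ (scatHalf (n + 1) ζ) (scatHalf_det (n + 1) ζ)) ?_ ?_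
  · rw [← det_defect]
    convert h using 2
    ext m l
    have hs := sum_rowProd_succ ζ m l
    rw [Matrix.of_apply, Matrix.of_apply]
    have hsum : ∑ k ∈ Finset.range n, ∑ j,
        (C (aProd ζ : ℂ) * scatHalf (n + 1) ζ 0 j).coeff (-((m.val : ℤ) + 1) - k) *
          starRingEnd ℂ ((C (aProd ζ : ℂ) * scatHalf (n + 1) ζ 0 j).coeff
            (-((l.val : ℤ) + 1) - k)) = (aProd ζ : ℂ) ^ 2 *
        ((1 + ζ 0 * starRingEnd ℂ (ζ 0)) *
        ((if m.val = l.val then (tsq (Fin.tail ζ) : ℂ) else 0) - defect (Fin.tail ζ) m l)) := by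
      rw [← hs, Finset.mul_sum]
      refine Finset.sum_congr rfl fun k _ => ?_
      simp only [Fin.sum_univ_two, coeff_C_mul, map_mul, Complex.conj_ofReal, scatHalf, cornerProd,
        Matrix.of_apply, Matrix.cons_val_zero, Matrix.cons_val_one, Matrix.cons_val', coeff_T_mul,
        neg_add']
      ring
    rw [hsum, div_eq_iff (tsq_ne_zero (Fin.tail ζ))]
    have ha := ofReal_aProd_sq ζ
    rw [ofReal_tsq_succ] at ha
    simp only [Fin.ext_iff]
    split_ifs
    · linear_combination (tsq (Fin.tail ζ) - defect (Fin.tail ζ) m l) * ha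
    · linear_combination (- defect (Fin.tail ζ) m l) * ha
  · intro i j m
    have h := conj_coeff_scat (n + 1) ζ
    have h' := conj_coeff_scat_lower (n + 1) ζ
    fin_cases i <;> fin_cases j <;>
      simp [coeff_C_mul, scatHalf, coeff_T_mul, -T_mul, h, h', add_comm, sub_eq_add_neg]
  · intro j m hm
    have h := coeff_scat_support (n + 1) ζ
    rw [coeff_C_mul]
    fin_cases j
    · simp [scatHalf, coeff_T_mul, -T_mul, (h (m + 1)).2 (Or.inl (by omega))]
    · simp [scatHalf, (h m).1 (Or.inl hm)]
  · intro j m hm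
    have h := coeff_scat_upper_support (Fin.tail ζ) m hm
    rw [coeff_C_mul]
    fin_cases j
    · simp [scatHalf, coeff_scat_succ_00, h]
    · simp [scatHalf, coeff_T_mul, -T_mul, coeff_scat_succ_01, h]

/-! ### The factorization `g = l a u` -/

/-- The Laurent polynomial `∑ x_j z^{-j}`. -/
def unipL (x : Fin n → ℂ) : ℂ[T;T⁻¹] := ∑ j : Fin n, C (x j) * T (-((j.val : ℤ) + 1))

theorem ev_unipL (x : Fin n → ℂ) (z : Circle) :
    ev z (unipL x) = ∑ j : Fin n, x j * ((z : ℂ)⁻¹) ^ (j.val + 1) := by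
  rw [unipL, map_sum]
  refine Finset.sum_congr rfl fun j _ => ?_
  rw [map_mul, ev_C, ev_T, zpow_neg, inv_pow]
  norm_cast

theorem coeff_unipL_mul (x : Fin n → ℂ) (f : ℂ[T;T⁻¹]) (m : ℤ) :
    (unipL x * f).coeff m = pairing x f (-m) := by
  rw [unipL, Finset.sum_mul, AddMonoidAlgebra.coeff_sum, Finsupp.finsetSum_apply, pairing]
  refine Finset.sum_congr rfl fun j _ => ?_
  rw [mul_assoc, coeff_C_mul, coeff_T_mul]
  congr 2
  ring

theorem coeff_unipL (x : Fin n → ℂ) (j : Fin n) :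
    (unipL x).coeff (-((j.val : ℤ) + 1)) = x j := by
  have h := coeff_unipL_mul x 1 (-((j.val : ℤ) + 1))
  rw [mul_one] at h
  rw [h, pairing, Finset.sum_eq_single j]
  · simp
  · intro i _ hij
    rw [coeff_one, if_neg, mul_zero]
    intro h0
    exact hij (Fin.ext (by omega))
  · simp

theorem unip_injective : Function.Injective (unip : (Fin n → ℂ) → Loop) := by
  intro x y h
  have he : ∀ z : Circle, ev z (unipL x) = ev z (unipL y) := fun z => by
    rw [ev_unipL, ev_unipL]
    exact congrFun (congrFun (congrArg Subtype.val (congrFun h z)) 0) 1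
  ext j
  rw [← coeff_unipL x j, ← coeff_unipL y j, ← fourierCoeff_ev, ← fourierCoeff_ev]
  simp only [he]

theorem exists_toLaurent (f : ℂ[T;T⁻¹]) (hf : ∀ m < 0, f.coeff m = 0) :
    ∃ p : Polynomial ℂ, Polynomial.toLaurent p = f := by
  refine ⟨∑ m ∈ f.coeff.support, Polynomial.monomial m.toNat (f.coeff m), ?_⟩
  rw [map_sum]
  refine Eq.trans ?_ f.sum_coeff_single
  refine Finset.sum_congr rfl fun m hm => ?_
  have hm0 : 0 ≤ m := by
    by_contra h
    exact Finsupp.mem_support_iff.1 hm (hf m (not_le.1 h))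
  rw [← Polynomial.C_mul_X_pow_eq_monomial, Polynomial.toLaurent_C_mul_X_pow, Int.toNat_of_nonneg hm0,
    ← single_eq_C_mul_T]

theorem ev_toLaurent (z : Circle) (p : Polynomial ℂ) :
    ev z (Polynomial.toLaurent p) = p.eval (z : ℂ) := by
  rw [ev, eval₂_toLaurent]
  rfl

theorem coeff_toLaurent_zero (p : Polynomial ℂ) :
    (Polynomial.toLaurent p).coeff 0 = p.eval 0 := by
  induction p using Polynomial.induction_on' with
  | add p q hp hq => rw [map_add, coeff_add, hp, hq, Polynomial.eval_add]
  | monomial k a =>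
    rw [← Polynomial.C_mul_X_pow_eq_monomial, Polynomial.toLaurent_C_mul_X_pow, coeff_C_mul,
      T_apply]
    rcases eq_or_ne k 0 with rfl | hk
    · simp
    · simp [hk]

/-- A loop whose entries are Laurent polynomials without negative powers lies in `N⁺` if its value
at `0` is upper triangular unipotent. -/
theorem mem_Nplus_of_laurent (u : Loop) (f : Fin 2 → Fin 2 → ℂ[T;T⁻¹])
    (hu : ∀ z i j, (u z).1 i j = ev z (f i j)) (hdet : f 0 0 * f 1 1 - f 0 1 * f 1 0 = 1)
    (hf : ∀ i j, ∀ m < 0, (f i j).coeff m = 0) (h00 : (f 0 0).coeff 0 = 1)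
    (h10 : (f 1 0).coeff 0 = 0) (h11 : (f 1 1).coeff 0 = 1) : u ∈ Nplus := by
  choose p hp using fun i j => exists_toLaurent (f i j) (hf i j)
  refine ⟨fun z => Matrix.of fun i j => (p i j).eval z, fun i j z _ => ?_, fun z _ => ?_, ?_, ?_, ?_,
    fun z => ?_⟩
  · exact (p i j).differentiable.analyticAt z
  · have h : p 0 0 * p 1 1 - p 0 1 * p 1 0 = 1 := by
      apply Polynomial.toLaurent_injective
      rw [map_sub, map_mul, map_mul, hp, hp, hp, hp, hdet, map_one]
    rw [Matrix.det_fin_two]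
    simpa using congrArg (Polynomial.eval z) h
  · exact (coeff_toLaurent_zero (p 0 0)).symm.trans (by rw [hp, h00])
  · exact (coeff_toLaurent_zero (p 1 0)).symm.trans (by rw [hp, h10])
  · exact (coeff_toLaurent_zero (p 1 1)).symm.trans (by rw [hp, h11])
  · ext i j
    rw [hu, ← hp, ev_toLaurent]
    rfl

/-- The entries of `u` in the factorization `g = l a u`. -/
def uEntry (n : ℕ) (ζ : Fin n → ℂ) : Matrix (Fin 2) (Fin 2) ℂ[T;T⁻¹] :=
  !![C ((aProd ζ : ℂ) ^ 2) * (scat n ζ 0 0 - unipL (coordEquiv n ζ) * scat n ζ 1 0),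
    C ((aProd ζ : ℂ) ^ 2) * (scat n ζ 0 1 - unipL (coordEquiv n ζ) * scat n ζ 1 1);
    scat n ζ 1 0, scat n ζ 1 1]

theorem corresponds_unip_coordEquiv (n : ℕ) (ζ : Fin n → ℂ) :
    Corresponds n ζ (unip (coordEquiv n ζ)) := by
  have ha := aProd_pos ζ
  have ha0 : (aProd ζ : ℂ) ≠ 0 := by exact_mod_cast ha.ne'
  have hti : 0 < (aProd ζ)⁻¹ := inv_pos.2 ha
  set l := unip (coordEquiv n ζ) with hl
  -- The value of `t` is forced: the lower right entry of `u` is `t` times that of `g`, and it must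
  -- equal `1` at `0`, where `D` is `1`.
  refine ⟨unip_mem_Ncell _, (aProd ζ)⁻¹, hti,
    (l * fun _ => diagPos _ hti)⁻¹ * gLoop n ζ, ?_, by group⟩
  obtain ⟨h1, h2⟩ := pairing_coordEquiv n ζ
  have hs := coeff_scat_support n ζ
  have hsq : C ((aProd ζ : ℂ) ^ 2) * C (tsq ζ : ℂ) = (1 : ℂ[T;T⁻¹]) := by
    rw [← map_mul, ofReal_aProd_sq, map_one]
  refine mem_Nplus_of_laurent _ (fun i j => uEntry n ζ i j) (fun z i j => ?_) ?_ ?_ ?_ ?_ ?_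
  · have h : (((l * fun _ => diagPos _ hti)⁻¹ * gLoop n ζ) z).1 =
      ((l z).1 * (diagPos _ hti).1).adjugate * (gLoop n ζ z).1 := rfl
    rw [h, Matrix.eta_fin_two (gLoop n ζ z).1]
    simp only [gLoop_apply, hl, unip, diagPos, ← ev_unipL]
    fin_cases i <;> fin_cases j <;>
      simp [uEntry, Matrix.mul_apply, Fin.sum_univ_two, Matrix.adjugate_fin_two, ev_C] <;>
      field_simp <;> ring
  · simp only [uEntry, Matrix.of_apply, Matrix.cons_val_zero, Matrix.cons_val_one,
      Matrix.cons_val']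
    linear_combination C ((aProd ζ : ℂ) ^ 2) * scat_det n ζ + hsq
  · intro i j m hm
    have hc := conj_coeff_scat_lower n ζ (-m)
    rw [neg_neg] at hc
    fin_cases i <;> fin_cases j
    · have h := h2 (-m) (by omega)
      rw [if_neg (by omega), hc.1] at h
      refine (coeff_C_mul _ _ m).trans ?_
      rw [coeff_sub, coeff_unipL_mul, h, mul_zero]
    · have h := h1 (-m) (by omega)
      rw [hc.2, neg_neg] at h
      refine (coeff_C_mul _ _ m).trans ?_
      rw [coeff_sub, coeff_unipL_mul, h, sub_self, mul_zero]
    · exact (hs m).2 (Or.inl (by omega))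
    · exact (hs m).1 (Or.inl hm)
  · have h := h2 0 le_rfl
    rw [(conj_coeff_scat_lower n ζ 0).1, if_pos rfl, neg_zero] at h
    simp only [uEntry, Matrix.of_apply, Matrix.cons_val_zero, Matrix.cons_val',
      coeff_C_mul, coeff_sub, coeff_unipL_mul, neg_zero]
    rw [h, ofReal_aProd_sq]
  · exact (hs 0).2 (Or.inl (by omega))
  · exact coeff_scat_11_zero n ζ

/-- The difference of the two upper right entries is a polynomial in `z⁻¹` without constant term
that extends holomorphically to the disk, so it vanishes. -/
theorem eq_of_unip_mul_eq {x y : Fin n → ℂ} {t s : ℝ} {ht : 0 < t} {hs : 0 < s} {u v : Loop}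
    (hu : u ∈ Nplus) (hv : v ∈ Nplus)
    (h : unip x * (fun _ => diagPos t ht) * u = unip y * (fun _ => diagPos s hs) * v) : x = y := by
  obtain ⟨F, hF, hFdet, -, -, -, hFu⟩ := hu
  obtain ⟨G, hG, -, -, -, -, hGv⟩ := hv
  have ht0 : (t : ℂ) ≠ 0 := by exact_mod_cast ht.ne'
  -- Taking the determinant of the upper row of `u` against the difference of upper rows, and using
  -- `det u = 1`, solves for `X - Y` without dividing by an entry of `u` that may vanish.
  have hE : ∀ z : Circle, ∑ j : Fin n, (x j - y j) * ((z : ℂ)⁻¹) ^ (j.val + 1) =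
      t * (F z 0 0 * (s * G z 0 1 - t * F z 0 1) - F z 0 1 * (s * G z 0 0 - t * F z 0 0)) := by
    intro z
    have hz := congrArg Subtype.val (congrFun h z)
    have hl : ((unip x * (fun _ => diagPos t ht) * u : Loop) z).1 =
      (unip x z).1 * (diagPos t ht).1 * (u z).1 := rfl
    have hr : ((unip y * (fun _ => diagPos s hs) * v : Loop) z).1 =
      (unip y z).1 * (diagPos s hs).1 * (v z).1 := rfl
    rw [hl, hr, hFu, hGv] at hz
    have hd := hFdet z (mem_closedBall_zero_iff.2 z.norm_coe.le)
    rw [Matrix.det_fin_two] at hd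
    have e00 := congrFun (congrFun hz 0) 0
    have e01 := congrFun (congrFun hz 0) 1
    have e10 := congrFun (congrFun hz 1) 0
    have e11 := congrFun (congrFun hz 1) 1
    simp only [unip, diagPos, Matrix.mul_apply, Fin.sum_univ_two, Matrix.of_apply,
      Matrix.cons_val_zero, Matrix.cons_val_one, Matrix.cons_val', one_mul, mul_zero, add_zero,
      zero_mul, zero_add] at e00 e01 e10 e11
    simp only [sub_mul, Finset.sum_sub_distrib]
    set X := ∑ j : Fin n, x j * ((z : ℂ)⁻¹) ^ (j.val + 1)
    set Y := ∑ j : Fin n, y j * ((z : ℂ)⁻¹) ^ (j.val + 1)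
    have e01' : s * G z 0 1 - t * F z 0 1 = (X - Y) * ((t : ℂ)⁻¹ * F z 1 1) := by
      linear_combination -e01 + Y * e11
    have e00' : s * G z 0 0 - t * F z 0 0 = (X - Y) * ((t : ℂ)⁻¹ * F z 1 0) := by
      linear_combination -e00 + Y * e10
    rw [e01', e00']
    field_simp
    linear_combination -(X - Y) * hd
  have hA : AnalyticOnNhd ℂ (fun z => (t : ℂ) * (F z 0 0 * (s * G z 0 1 - t * F z 0 1) -
      F z 0 1 * (s * G z 0 0 - t * F z 0 0))) (Metric.closedBall 0 1) := fun z hz => by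
    have := hF 0 0 z hz
    have := hF 0 1 z hz
    have := hG 0 0 z hz
    have := hG 0 1 z hz
    fun_prop
  have hB : AnalyticOnNhd ℂ (fun w : ℂ => ∑ j : Fin n, (x j - y j) * w ^ (j.val + 1))
      (Metric.closedBall 0 1) := fun w _ =>
    (show Differentiable ℂ fun w : ℂ => ∑ j : Fin n, (x j - y j) * w ^ (j.val + 1) by
      fun_prop).analyticAt w
  have h0 : unip (fun j => x j - y j) = unip (0 : Fin n → ℂ) := by
    refine funext fun z => Subtype.ext ?_
    have := eq_apply_zero_of_eq_inv hB hA (fun z => by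
      have := hE z⁻¹
      rw [Circle.coe_inv, inv_inv] at this
      exact this) z⁻¹
    rw [Circle.coe_inv] at this
    simp only [unip, this]
    simp
  have := unip_injective h0
  ext j
  exact sub_eq_zero.1 (congrFun this j)

theorem corresponds_iff (hn : 0 < n) (ζ : Fin n → ℂ) (l : Loop) :
    Corresponds n ζ l ↔ l = unip (coordEquiv n ζ) := by
  constructor
  · rintro ⟨hl, t, ht, u, hu, h⟩
    obtain ⟨x, rfl⟩ := eq_unip_of_mem_Ncell hn hl
    obtain ⟨-, s, hs, v, hv, h'⟩ := corresponds_unip_coordEquiv n ζ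
    rw [eq_of_unip_mul_eq hu hv (h.symm.trans h')]
  · rintro rfl
    exact corresponds_unip_coordEquiv n ζ

/-! ### Smoothness -/

theorem contDiff_tail (n : ℕ) : ContDiff ℝ ∞ (Fin.tail : (Fin (n + 1) → ℂ) → Fin n → ℂ) :=
  contDiff_pi.2 fun j => contDiff_apply ℝ ℂ j.succ

theorem contDiff_coeff_scat (n : ℕ) (m : ℤ) :
    ContDiff ℝ ∞ (fun ζ : Fin n → ℂ => (scat n ζ 1 1).coeff m) ∧
      ContDiff ℝ ∞ (fun ζ : Fin n → ℂ => (scat n ζ 1 0).coeff m) := by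
  induction n generalizing m with
  | zero => exact ⟨contDiff_const, contDiff_const⟩
  | succ n ih =>
    have h0 : ContDiff ℝ ∞ fun ζ : Fin (n + 1) → ℂ => ζ 0 := contDiff_apply ℝ ℂ 0
    have hc : ContDiff ℝ ∞ fun ζ : Fin (n + 1) → ℂ => starRingEnd ℂ (ζ 0) :=
      Complex.conjCLE.contDiff.comp h0
    have ht := contDiff_tail n
    simp only [coeff_scat_succ_11, coeff_scat_succ_10]
    exact ⟨((ih m).1.comp ht).add (h0.mul ((ih m).2.comp ht)),
      ((ih (m - 1)).2.comp ht).sub (hc.mul ((ih (m - 1)).1.comp ht))⟩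

theorem contDiff_tsq (n : ℕ) : ContDiff ℝ ∞ (fun ζ : Fin n → ℂ => (tsq ζ : ℂ)) := by
  have h : ContDiff ℝ ∞ (fun ζ : Fin n → ℂ => tsq ζ) :=
    contDiff_prod fun j _ => contDiff_const.add ((contDiff_norm_sq ℝ).comp (contDiff_apply ℝ ℂ j))
  exact Complex.ofRealCLM.contDiff.comp h

theorem contDiff_coordEquiv (n : ℕ) : ContDiff ℝ ∞ (coordEquiv n) := by
  induction n with
  | zero => exact contDiff_id
  | succ n ih =>
    have h0 : ContDiff ℝ ∞ fun ζ : Fin (n + 1) → ℂ => ζ 0 := contDiff_apply ℝ ℂ 0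
    have ht := contDiff_tail n
    refine contDiff_pi.2 fun j => Fin.cases ?_ (fun j => ?_) j
    · simp only [coordEquiv_zero, pairing]
      refine (((contDiff_tsq n).comp ht).mul h0).sub (ContDiff.sum fun j _ => ?_)
      exact ((contDiff_pi.1 ih j).comp ht).mul ((contDiff_coeff_scat n _).1.comp ht)
    · exact (contDiff_pi.1 ih j).comp ht

theorem contDiff_coordEquiv_symm (n : ℕ) : ContDiff ℝ ∞ (coordEquiv n).symm := by
  induction n with
  | zero => exact contDiff_id
  | succ n ih =>
    have h0 : ContDiff ℝ ∞ fun x : Fin (n + 1) → ℂ => x 0 := contDiff_apply ℝ ℂ 0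
    have ht := contDiff_tail n
    have hs := ih.comp ht
    refine contDiff_pi.2 fun j => Fin.cases ?_ (fun j => ?_) j
    · refine (h0.add (ContDiff.sum fun j _ => ?_)).mul
        (((contDiff_tsq n).comp hs).inv fun x => tsq_ne_zero _)
      exact ((contDiff_apply ℝ ℂ j).comp ht).mul ((contDiff_coeff_scat n _).1.comp hs)
    · exact (contDiff_pi.1 ih j).comp ht

/-! ### The Jacobian -/

theorem measurable_fin_cons : Measurable fun p : ℂ × (Fin n → ℂ) =>
    (Fin.cons p.1 p.2 : Fin (n + 1) → ℂ) :=
  measurable_pi_iff.2 fun j => Fin.cases measurable_fst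
    (fun j => (measurable_pi_apply j).comp measurable_snd) j

theorem lintegral_fin_cons (f : (Fin (n + 1) → ℂ) → ENNReal) (hf : Measurable f) :
    ∫⁻ ζ, f ζ = ∫⁻ ζ : Fin n → ℂ, ∫⁻ a : ℂ, f (Fin.cons a ζ) := by
  have hp := (volume_preserving_piFinSuccAbove (fun _ : Fin (n + 1) => ℂ) 0).symm
  have he : ∀ p, (MeasurableEquiv.piFinSuccAbove (fun _ : Fin (n + 1) => ℂ) 0).symm p =
      Fin.cons p.1 p.2 := fun p => Fin.insertNth_zero' _ _
  rw [← hp.lintegral_comp hf]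
  simp only [he]
  exact lintegral_prod_symm' (fun p : ℂ × (Fin n → ℂ) => f (Fin.cons p.1 p.2))
    (hf.comp measurable_fin_cons)

/-- A real dilation by `c` of the plane scales area by `c ^ 2`; with `c = tsq` of the tail this is
one step of the Jacobian. -/
theorem lintegral_comp_mul_sub (f : ℂ → ENNReal) (hf : Measurable f) {c : ℝ} (hc : 0 < c) (b : ℂ) :
    ∫⁻ a : ℂ, f (c * a - b) * ENNReal.ofReal (c ^ 2) = ∫⁻ a, f a := by
  have h := Measure.map_addHaar_smul (volume : Measure ℂ) hc.ne'
  have hg : Measurable fun a : ℂ => f (a - b) := hf.comp (measurable_id.sub_const b)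
  have h1 : ∫⁻ a : ℂ, f (c * a - b) = ENNReal.ofReal ((c ^ 2)⁻¹) * ∫⁻ a, f a := by
    have := lintegral_map (μ := (volume : Measure ℂ)) hg (measurable_const_smul c)
    rw [h, lintegral_smul_measure, lintegral_sub_right_eq_self, Complex.finrank_real_complex,
      abs_of_pos (by positivity)] at this
    simpa only [Complex.real_smul, smul_eq_mul] using this.symm
  rw [lintegral_mul_const' _ _ ENNReal.ofReal_ne_top, h1, mul_right_comm,
    ← ENNReal.ofReal_mul (by positivity), inv_mul_cancel₀ (by positivity), ENNReal.ofReal_one,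
    one_mul]

/-- The Jacobian of the coordinate change. -/
def jac (ζ : Fin n → ℂ) : ℝ := ∏ j : Fin n, (1 + ‖ζ j‖ ^ 2) ^ (2 * j.val)

theorem jac_cons (a : ℂ) (ζ : Fin n → ℂ) :
    jac (Fin.cons a ζ : Fin (n + 1) → ℂ) = tsq ζ ^ 2 * jac ζ := by
  rw [jac, Fin.prod_univ_succ, tsq, jac, ← Finset.prod_pow, ← Finset.prod_mul_distrib]
  simp only [Fin.val_zero, mul_zero, pow_zero, one_mul, Fin.cons_succ, Fin.val_succ]
  exact Finset.prod_congr rfl fun j _ => by ring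

theorem measurable_jac : Measurable fun ζ : Fin n → ℂ => ENNReal.ofReal (jac ζ) := by
  unfold jac
  fun_prop

/-- The change of variables is triangular: by Tonelli, integrate over `ζ 0` with the tail fixed,
where the map is affine, then apply induction to the tail. No general Jacobian formula is needed. -/
theorem lintegral_coordEquiv (n : ℕ) (f : (Fin n → ℂ) → ENNReal) (hf : Measurable f) :
    ∫⁻ ζ, f (coordEquiv n ζ) * ENNReal.ofReal (jac ζ) = ∫⁻ x, f x := by
  induction n with
  | zero => simp [jac, coordEquiv]
  | succ n ih =>
    have hx : Measurable (coordEquiv (n + 1)) := (contDiff_coordEquiv _).continuous.measurable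
    have hG : Measurable fun x : Fin n → ℂ => ∫⁻ a : ℂ, f (Fin.cons a x) :=
      (hf.comp measurable_fin_cons).lintegral_prod_left'
    have hm : Measurable fun ζ : Fin (n + 1) → ℂ =>
        f (coordEquiv (n + 1) ζ) * ENNReal.ofReal (jac ζ) := (hf.comp hx).mul measurable_jac
    rw [lintegral_fin_cons f hf, lintegral_fin_cons _ hm, ← ih _ hG]
    refine lintegral_congr fun ζ => ?_
    have hfc : Measurable fun a : ℂ => f (Fin.cons a (coordEquiv n ζ)) :=
      hf.comp (measurable_fin_cons.comp (measurable_id.prodMk measurable_const))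
    rw [← lintegral_comp_mul_sub _ hfc (tsq_pos ζ)
      (pairing (coordEquiv n ζ) (scat n ζ 1 1) 0),
      ← lintegral_mul_const' _ _ ENNReal.ofReal_ne_top]
    refine lintegral_congr fun a => ?_
    rw [jac_cons, ENNReal.ofReal_mul (by positivity), mul_assoc]
    rfl

theorem map_coordEquiv (n : ℕ) :
    ((volume : Measure (Fin n → ℂ)).withDensity fun ζ => ENNReal.ofReal (jac ζ)).map
      (coordEquiv n) = volume := by
  have hx : Measurable (coordEquiv n) := (contDiff_coordEquiv _).continuous.measurable
  ext s hs
  rw [Measure.map_apply hx hs, withDensity_apply _ (hx hs), ← lintegral_indicator (hx hs),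
    ← lintegral_indicator_one hs, ← lintegral_coordEquiv n _ (measurable_one.indicator hs)]
  refine lintegral_congr fun ζ => ?_
  by_cases h : coordEquiv n ζ ∈ s
  · rw [Set.indicator_of_mem (Set.mem_preimage.2 h), Set.indicator_of_mem h, Pi.one_apply, one_mul]
  · rw [Set.indicator_of_notMem (by simpa using h), Set.indicator_of_notMem h, zero_mul]

/-! ### The determinants of the loops -/

theorem absSigma0_gLoop_sq (n : ℕ) (ζ : Fin n → ℂ) :
    absSigma0 (gLoop n ζ) ^ 2 = ∏ j : Fin n, 1 / (1 + ‖ζ j‖ ^ 2) ^ (j.val + 1) :=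
  absSigma0_sq (hasInfDet_gLoop n ζ) (Finset.prod_nonneg fun _ _ => by positivity)

theorem absSigma1_gLoop_sq (n : ℕ) (ζ : Fin (n + 1) → ℂ) :
    absSigma1 (gLoop (n + 1) ζ) ^ 2 =
      ∏ j : Fin n, 1 / (1 + ‖Fin.tail ζ j‖ ^ 2) ^ (j.val + 1) :=
  absSigma0_sq (hasInfDet_halfConj_gLoop n ζ) (Finset.prod_nonneg fun _ _ => by positivity)

theorem det_hankelB_coordEquiv (n : ℕ) (ζ : Fin n → ℂ) :
    (1 + hankelB (coordEquiv n ζ) * (hankelB (coordEquiv n ζ))ᴴ).det =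
      ((∏ j : Fin n, (1 + ‖ζ j‖ ^ 2) ^ (j.val + 1) : ℝ) : ℂ) := by
  rw [det_one_add_hankelB, det_one_add_hankel]

theorem ofReal_prod_one_div (n : ℕ) (ζ : Fin n → ℂ) :
    ((∏ j : Fin n, 1 / (1 + ‖ζ j‖ ^ 2) ^ (j.val + 1) : ℝ) : ℂ) =
      1 / (1 + hankelB (coordEquiv n ζ) * (hankelB (coordEquiv n ζ))ᴴ).det := by
  rw [det_hankelB_coordEquiv, ← Complex.ofReal_one, ← Complex.ofReal_div]
  simp only [one_div, Finset.prod_inv_distrib]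

theorem absSigma0_div_absSigma1 (n : ℕ) (ζ : Fin (n + 1) → ℂ) :
    absSigma0 (gLoop (n + 1) ζ) / absSigma1 (gLoop (n + 1) ζ) =
      ∏ j, 1 / (1 + ‖ζ j‖ ^ 2) ^ (1 / 2 : ℝ) := by
  have h0 : 0 ≤ absSigma0 (gLoop (n + 1) ζ) := Real.sqrt_nonneg _
  have h1 : 0 ≤ absSigma1 (gLoop (n + 1) ζ) := Real.sqrt_nonneg _
  refine (sq_eq_sq₀ (div_nonneg h0 h1)
    (Finset.prod_nonneg fun _ _ => by positivity)).1 ?_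
  have hB : (∏ j : Fin n, 1 / (1 + ‖Fin.tail ζ j‖ ^ 2) ^ (j.val + 1) : ℝ) ≠ 0 :=
    Finset.prod_ne_zero_iff.2 fun j _ => by positivity
  have hR : (∏ j, 1 / (1 + ‖ζ j‖ ^ 2) ^ (1 / 2 : ℝ)) ^ 2 = ∏ j, 1 / (1 + ‖ζ j‖ ^ 2) := by
    rw [← Finset.prod_pow]
    refine Finset.prod_congr rfl fun j _ => ?_
    rw [← Real.sqrt_eq_rpow, div_pow, one_pow, Real.sq_sqrt (by positivity)]
  rw [div_pow, absSigma0_gLoop_sq, absSigma1_gLoop_sq, div_eq_iff hB, hR, Fin.prod_univ_succ,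
    Fin.prod_univ_succ (fun j : Fin (n + 1) => 1 / (1 + ‖ζ j‖ ^ 2)), mul_assoc,
    ← Finset.prod_mul_distrib]
  simp [Fin.tail, pow_succ _ (_ + 1), mul_comm]

end LoopSU2

end

theorem theorem6p1 :
    -- (a)
    (∀ n : ℕ, 0 < n → Ncell n = {l | ∃ x : Fin n → ℂ, l = unip x}) ∧
    -- the coordinate changes `ζ ↦ x⁽ⁿ⁾(ζ)`
    ∃ x : (n : ℕ) → (Fin n → ℂ) ≃ (Fin n → ℂ),
      (∀ n : ℕ, 0 < n →
        (∀ (ζ : Fin n → ℂ) (z : Circle),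
          (gLoop n ζ z : Matrix (Fin 2) (Fin 2) ℂ) ∈ Matrix.specialUnitaryGroup (Fin 2) ℂ) ∧
        (∀ (ζ : Fin n → ℂ) (l : Loop), Corresponds n ζ l ↔ l = unip (x n ζ)) ∧
        ContDiff ℝ ∞ (x n) ∧ ContDiff ℝ ∞ (x n).symm) ∧
      -- (b)
      (∀ (n N : ℕ) (_ : 0 < n) (hN : n < N) (ζ : Fin n → ℂ) (j : Fin n),
        x n ζ j = x N (pad N 0 ζ) (Fin.castLE hN.le j)) ∧
      (∀ (n N : ℕ) (j : Fin n) (hN : n - j.val ≤ N) (ζ : Fin n → ℂ),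
        x n ζ j = x N (pad N j.val ζ) ⟨0, by have := j.2; omega⟩) ∧
      -- (c)
      (∀ (n : ℕ) (_ : 0 < n) (ζ : Fin n → ℂ),
        HasInfDet (toeplitzGram (gLoop n ζ)) ((absSigma0 (gLoop n ζ) ^ 2 : ℝ) : ℂ) ∧
        ((absSigma0 (gLoop n ζ) ^ 2 : ℝ) : ℂ) =
          1 / (1 + hankelB (x n ζ) * (hankelB (x n ζ))ᴴ).det ∧
        absSigma0 (gLoop n ζ) ^ 2 = ∏ j : Fin n, 1 / (1 + ‖ζ j‖ ^ 2) ^ (j.val + 1) ∧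
        HasInfDet (toeplitzGram (halfConj (gLoop n ζ)))
          ((absSigma1 (gLoop n ζ) ^ 2 : ℝ) : ℂ) ∧
        ((absSigma1 (gLoop n ζ) ^ 2 : ℝ) : ℂ) =
          1 / (1 + hankelB (drop 1 (x n ζ)) * (hankelB (drop 1 (x n ζ)))ᴴ).det ∧
        absSigma1 (gLoop n ζ) ^ 2 =
          ∏ j : Fin (n - 1), 1 / (1 + ‖drop 1 ζ j‖ ^ 2) ^ (j.val + 1) ∧
        absSigma0 (gLoop n ζ) / absSigma1 (gLoop n ζ) =
          ∏ j : Fin n, 1 / (1 + ‖ζ j‖ ^ 2) ^ (1 / 2 : ℝ)) ∧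
      -- (d)
      (∀ (n l : ℕ) (_ : l < n) (ζ : Fin n → ℂ),
        (1 + hankelB (drop l (x n ζ)) * (hankelB (drop l (x n ζ)))ᴴ).det =
          ((∏ j : Fin (n - l), (1 + ‖drop l ζ j‖ ^ 2) ^ (j.val + 1) : ℝ) : ℂ)) ∧
      -- (e)
      (∀ n : ℕ, 0 < n →
        ((volume : Measure (Fin n → ℂ)).withDensity fun ζ =>
          ENNReal.ofReal (∏ j : Fin n, (1 + ‖ζ j‖ ^ 2) ^ (2 * j.val))).map (x n) = volume) := by
  refine ⟨fun n hn => Ncell_eq hn, coordEquiv, fun n hn => ⟨gLoop_mem_specialUnitaryGroup n,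
    corresponds_iff hn, contDiff_coordEquiv n, contDiff_coordEquiv_symm n⟩,
    fun n N _ hN ζ j => coordEquiv_pad n N hN.le ζ j, coordEquiv_pad_drop,
    fun n hn ζ => ?_, fun n l hl ζ => ?_, fun n _ => map_coordEquiv n⟩
  · obtain ⟨m, rfl⟩ : ∃ m, n = m + 1 := ⟨n - 1, by omega⟩
    have hd : drop 1 (coordEquiv (m + 1) ζ) = coordEquiv m (Fin.tail ζ) :=
      drop_coordEquiv (m + 1) 1 hn ζ
    refine ⟨?_, ?_, absSigma0_gLoop_sq _ ζ, ?_, ?_, absSigma1_gLoop_sq m ζ,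
      absSigma0_div_absSigma1 m ζ⟩
    · rw [absSigma0_gLoop_sq]
      exact hasInfDet_gLoop _ ζ
    · rw [absSigma0_gLoop_sq]
      exact ofReal_prod_one_div _ ζ
    · rw [absSigma1_gLoop_sq]
      exact hasInfDet_halfConj_gLoop m ζ
    · rw [absSigma1_gLoop_sq, hd]
      exact ofReal_prod_one_div m (Fin.tail ζ)
  · rw [drop_coordEquiv n l hl.le]
    exact det_hankelB_coordEquiv _ _
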